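/- Let $G$ be a simple, locally finite directed graph with countable vertex set $V$ and countably many edges $e_j$, $j\in J$ ($G$ may be infinite): there are no loops, no two edges have the same tail and the same head, and every vertex is incident to only finitely many edges. Let $0\le w_{ij}\le 1$ ($i,j\in J$) be weights and let $\mathbb B=(\mathbb B_{ij})_{i,j\in J}$ be the weighted (transposed) adjacency matrix of the line graph, $\mathbb B_{ij}=w_{ij}$ if the head of $e_j$ is the tail of $e_i$, and $\mathbb B_{ij}=0$ otherwise. Assume that $\mathbb B$ is column stochastic, $\sum_{i\in J}\mathbb B_{ij}=1$ for all $j\in J$, so that it defines a bounded operator on $\ell^1=\ell^1(J)$. The scalars are real or complex. Let $X=L^\infty([0,1],\ell^1)$ with the norm $\|f\|=\operatorname{ess\,sup}_{s\in[0,1]}\|f(s)\|_{\ell^1}$, and let $\tau$ be the weak$^*$-topology on $X=L^1([0,1],c_0)'$, that is, the coarsest topology for which the functionals $f\mapsto\langle f,g\rangle=\int_0^1\sum_{j\in J}f_j(s)g_j(s)\,ds$, $g\in L^1([0,1],c_0)$, are continuous. Let $A$ be the operator on $X$ given by $$Av=v',\qquad D(A)=\{v\in W^{1,\infty}([0,1],\ell^1)\mid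 v(1)=\mathbb B v(0)\},$$ where $v'$ is the weak derivative and the boundary values are those of the continuous representative of $v$ (transport with all velocities equal to $1$ and no absorption). Then $A$ generates a contraction bi-continuous semigroup $(T(t))_{t\ge 0}$ on $X$ with respect to $\tau$, and this semigroup is given, for $f\in X$, $t\ge0$ and almost every $s\in[0,1]$, by $$T(t)f(s)=\mathbb B^n f(t+s-n),\qquad n\le t+s<n+1,\ n\in\mathbb N_0 .$$ Here, $(T(t))_{t\ge0}$ being a bi-continuous semigroup on $X$ with respect to $\tau$ means the following. First, $X$ is a Banach space and $\tau$ is a Hausdorff locally convex topology on $X$, coarser than the norm topology, such that every norm-bounded $\tau$-Cauchy sequence is $\tau$-convergent and $\|f\|=\sup\{|\varphi(f)| : \varphi\in(X,\tau)',\ \|\varphi\|\le1\}$ for all $f\in X$. Second, the $T(t)$ are bounded linear operators on $X$ with $T(0)=I$ and $T(t+s)=T(t)T(s)$; $t\mapsto T(t)f$ is $\tau$-continuous for every $f\in X$; $\|T(t)\|\le Me^{\omega t}$ for some $M\ge1$, $\omega\in\mathbb R$ and all $t\ge0$; and for every norm-bounded sequence $(f_n)$ with $f_n\to0$ in $\tau$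 and every $t_0\ge0$, $T(s)f_n\to0$ in $\tau$ uniformly for $s\in[0,t_0]$. Contraction means $\|T(t)\|\le1$ for all $t\ge0$. That $A$ is the generator means: $f\in D(A)$ and $Af=g$ if and only if $\frac{T(t)f-f}{t}\to g$ in $\tau$ as $t\downarrow0$ and $\sup_{0<t\le1}\frac{\|T(t)f-f\|}{t}<\infty$. -/

import Mathlib

open MeasureTheory Filter Set
open scoped Topology NNReal ENNReal ContDiff lp

noncomputable section

/-! ### Bi-continuous semigroups and their generators -/

section BiContinuous

/-- The norm topology. (It is named because in the definitions below a second topology `τ` on `X` is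
in scope.) -/
abbrev normTopology (X : Type*) [NormedAddCommGroup X] : TopologicalSpace X := inferInstance

/-- The norm bounded linear operators on `X`. -/
abbrev BoundedOp (𝕜 X : Type*) [RCLike 𝕜] [NormedAddCommGroup X] [NormedSpace 𝕜 X] := X →L[𝕜] X

/-- The norm bounded linear functionals on `X`. -/
abbrev BoundedFunctional (𝕜 X : Type*) [RCLike 𝕜] [NormedAddCommGroup X] [NormedSpace 𝕜 X] :=
  X →L[𝕜] 𝕜

/-- The standing compatibility assumptions between the norm of a Banach space `X` and an additional
locally convex topology `τ` on `X`. -/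
structure IsBiContTopology (𝕜 : Type*) {X : Type*} [RCLike 𝕜] [NormedAddCommGroup X]
    [NormedSpace 𝕜 X] (τ : TopologicalSpace X) : Prop where
  complete : CompleteSpace X
  topologicalAddGroup : @IsTopologicalAddGroup X τ _
  continuousSMul : @ContinuousSMul 𝕜 X _ _ τ
  /-- `τ` is locally convex: it is generated by its continuous seminorms. -/
  polynormable : @PolynormableSpace 𝕜 X _ _ _ τ
  hausdorff : @T2Space X τ
  /-- `τ` is coarser than the norm topology. -/
  coarser : @Continuous X X (normTopology X) τ (fun f => f)
  /-- Every norm bounded `τ`-Cauchy sequence is `τ`-convergent. -/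
  seqComplete : ∀ f : ℕ → X, (∃ C : ℝ, ∀ n, ‖f n‖ ≤ C) →
    Tendsto (fun p : ℕ × ℕ => f p.1 - f p.2) atTop (@nhds X τ 0) →
    ∃ g : X, Tendsto f atTop (@nhds X τ g)
  /-- The dual space of `(X, τ)` is norming. -/
  norming : ∀ f : X, IsLUB
    {r : ℝ | ∃ φ : BoundedFunctional 𝕜 X,
      @Continuous X 𝕜 τ inferInstance (fun x => φ x) ∧ ‖φ‖ ≤ 1 ∧ r = ‖φ f‖} ‖f‖

variable {𝕜 X : Type*} [RCLike 𝕜] [NormedAddCommGroup X] [NormedSpace 𝕜 X]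

/-- `(T(t))_{t ≥ 0}` is a bi-continuous semigroup on `X` with respect to `τ`. -/
structure IsBiContSemigroup (τ : TopologicalSpace X) (T : ℝ≥0 → BoundedOp 𝕜 X) : Prop where
  topology : IsBiContTopology 𝕜 τ
  map_zero : ∀ f : X, T 0 f = f
  map_add : ∀ (t s : ℝ≥0) (f : X), T (t + s) f = T t (T s f)
  /-- strong `τ`-continuity -/
  stronglyContinuous : ∀ f : X, @Continuous ℝ≥0 X inferInstance τ (fun t => T t f)
  exponentiallyBounded : ∃ M a : ℝ, 1 ≤ M ∧ ∀ t : ℝ≥0, ‖T t‖ ≤ M * Real.exp (a * t)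
  /-- local bi-equicontinuity: `T(s) fₙ → 0` in `τ`, uniformly for `s ∈ [0, t₀]`, whenever `(fₙ)` is
  norm bounded and `τ`-convergent to `0` -/
  locallyBiEquicontinuous : ∀ f : ℕ → X, (∃ C : ℝ, ∀ n, ‖f n‖ ≤ C) →
    Tendsto f atTop (@nhds X τ 0) →
    ∀ t₀ : ℝ≥0, ∀ U ∈ @nhds X τ 0, ∀ᶠ n in atTop, ∀ s ≤ t₀, T s (f n) ∈ U

/-- The operator `A` with domain `D(A)` is the generator of `(T(t))_{t ≥ 0}`: `f ∈ D(A)` and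
`A f = g` if and only if `(T(t) f - f) / t → g` in `τ` as `t ↓ 0` and
`sup_{0 < t ≤ 1} ‖T(t) f - f‖ / t < ∞`. -/
def IsBiContGenerator (τ : TopologicalSpace X) (T : ℝ≥0 → BoundedOp 𝕜 X) (A : X →ₗ.[𝕜] X) : Prop :=
  ∀ f g : X, (f, g) ∈ A.graph ↔
    Tendsto (fun t : ℝ≥0 => (((t : ℝ)⁻¹ : ℝ) : 𝕜) • (T t f - f)) (𝓝[>] 0) (@nhds X τ g) ∧
    ∃ C : ℝ, ∀ t : ℝ≥0, 0 < t → t ≤ 1 → ‖T t f - f‖ / t ≤ C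

end BiContinuous

/-! ### Functions on the unit interval and weak derivatives -/

/-- Lebesgue measure on `[0,1]`. -/
abbrev unitMeasure : Measure ℝ := volume.restrict (Icc (0 : ℝ) 1)

section Sobolev

variable {𝕜 E : Type*} [RCLike 𝕜] [NormedAddCommGroup E] [NormedSpace ℝ E] [NormedSpace 𝕜 E]

/-- `g` is the weak derivative on `(0,1)` of `v`, for `v, g ∈ L^∞([0,1], E)`. -/
def HasWeakDeriv (v g : Lp E ∞ unitMeasure) : Prop :=
  ∀ φ : ℝ → ℝ, ContDiff ℝ ∞ φ → HasCompactSupport φ → tsupport φ ⊆ Ioo 0 1 →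
    ∫ s in Icc (0 : ℝ) 1, deriv φ s • v s = - ∫ s in Icc (0 : ℝ) 1, φ s • g s

theorem integrable_smul_of_compactSupport {φ : ℝ → ℝ} (hφ : Continuous φ)
    (hc : HasCompactSupport φ) (v : Lp E ∞ unitMeasure) :
    Integrable (fun s => φ s • v s) unitMeasure := by
  obtain ⟨C, hC⟩ := hc.exists_bound_of_continuous hφ
  have hv : Integrable v unitMeasure := (Lp.memLp v).integrable le_top
  exact hv.bdd_smul C hφ.aestronglyMeasurable (Eventually.of_forall hC)

theorem HasWeakDeriv.add {v₁ v₂ g₁ g₂ : Lp E ∞ unitMeasure} (h₁ : HasWeakDeriv v₁ g₁)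
    (h₂ : HasWeakDeriv v₂ g₂) : HasWeakDeriv (v₁ + v₂) (g₁ + g₂) := by
  intro φ hφ hc hs
  have hd : Continuous (deriv φ) := hφ.continuous_deriv (by simp)
  have e₁ : ∫ s in Icc (0 : ℝ) 1, deriv φ s • (v₁ + v₂) s
      = ∫ s in Icc (0 : ℝ) 1, (deriv φ s • v₁ s + deriv φ s • v₂ s) := by
    apply integral_congr_ae
    filter_upwards [Lp.coeFn_add v₁ v₂] with s hs
    rw [hs, Pi.add_apply, smul_add]
  have e₂ : ∫ s in Icc (0 : ℝ) 1, φ s • (g₁ + g₂) s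
      = ∫ s in Icc (0 : ℝ) 1, (φ s • g₁ s + φ s • g₂ s) := by
    apply integral_congr_ae
    filter_upwards [Lp.coeFn_add g₁ g₂] with s hs
    rw [hs, Pi.add_apply, smul_add]
  rw [e₁, e₂, integral_add (integrable_smul_of_compactSupport hd hc.deriv v₁)
    (integrable_smul_of_compactSupport hd hc.deriv v₂),
    integral_add (integrable_smul_of_compactSupport hφ.continuous hc g₁)
    (integrable_smul_of_compactSupport hφ.continuous hc g₂), h₁ φ hφ hc hs, h₂ φ hφ hc hs,
    neg_add]

theorem HasWeakDeriv.const_smul [SMulCommClass ℝ 𝕜 E] (c : 𝕜) {v g : Lp E ∞ unitMeasure}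
    (h : HasWeakDeriv v g) : HasWeakDeriv (c • v) (c • g) := by
  intro φ hφ hc hs
  have e₁ : ∫ s in Icc (0 : ℝ) 1, deriv φ s • (c • v) s
      = ∫ s in Icc (0 : ℝ) 1, c • (deriv φ s • v s) := by
    apply integral_congr_ae
    filter_upwards [Lp.coeFn_smul c v] with s hs
    rw [hs, Pi.smul_apply, smul_comm]
  have e₂ : ∫ s in Icc (0 : ℝ) 1, φ s • (c • g) s
      = ∫ s in Icc (0 : ℝ) 1, c • (φ s • g s) := by
    apply integral_congr_ae
    filter_upwards [Lp.coeFn_smul c g] with s hs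
    rw [hs, Pi.smul_apply, smul_comm]
  rw [e₁, e₂, integral_smul, integral_smul, h φ hφ hc hs, smul_neg]

theorem HasWeakDeriv.zero : HasWeakDeriv (0 : Lp E ∞ unitMeasure) 0 := by
  have h0 : ∀ φ : ℝ → ℝ, ∫ s in Icc (0 : ℝ) 1, φ s • (0 : Lp E ∞ unitMeasure) s = 0 := by
    intro φ
    rw [← integral_zero ℝ E (μ := unitMeasure)]
    apply integral_congr_ae
    filter_upwards [Lp.coeFn_zero E ∞ unitMeasure] with s hs
    rw [hs]
    simp
  intro φ _ _ _
  rw [h0, h0, neg_zero]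

theorem HasWeakDeriv.unique [CompleteSpace E] {v g₁ g₂ : Lp E ∞ unitMeasure}
    (h₁ : HasWeakDeriv v g₁) (h₂ : HasWeakDeriv v g₂) : g₁ = g₂ := by
  have key : ∀ᵐ s ∂(volume : Measure ℝ), s ∈ Ioo (0 : ℝ) 1 → g₁ s - g₂ s = 0 := by
    have hint : ∀ g : Lp E ∞ unitMeasure, IntegrableOn g (Icc (0 : ℝ) 1) := fun g =>
      (Lp.memLp g).integrable le_top
    apply isOpen_Ioo.ae_eq_zero_of_integral_contDiff_smul_eq_zero
    · exact (((hint g₁).sub (hint g₂)).mono_set Ioo_subset_Icc_self).locallyIntegrableOn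
    · intro φ hφ hc hs
      have hz : ∫ s, φ s • (g₁ s - g₂ s) = ∫ s in Icc (0 : ℝ) 1, φ s • (g₁ s - g₂ s) := by
        symm
        apply setIntegral_eq_integral_of_forall_compl_eq_zero
        intro s hs'
        rw [image_eq_zero_of_notMem_tsupport fun h => hs' (Ioo_subset_Icc_self (hs h)), zero_smul]
      have i₁ := integrable_smul_of_compactSupport hφ.continuous hc g₁
      have i₂ := integrable_smul_of_compactSupport hφ.continuous hc g₂
      rw [hz]
      simp_rw [smul_sub]
      rw [integral_sub i₁ i₂, sub_eq_zero, ← neg_inj, ← h₁ φ hφ hc hs, ← h₂ φ hφ hc hs]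
  apply Lp.ext
  have hae : unitMeasure = volume.restrict (Ioo (0 : ℝ) 1) :=
    (Measure.restrict_congr_set Ioo_ae_eq_Icc).symm
  have := (ae_restrict_iff' measurableSet_Ioo).2 key
  rw [← hae] at this
  filter_upwards [this] with s hs
  exact sub_eq_zero.1 hs

/-- The Sobolev space `W^{1,∞}([0,1], E)`, as a subspace of `L^∞([0,1], E)`. -/
def sobolev (𝕜 E : Type*) [RCLike 𝕜] [NormedAddCommGroup E] [NormedSpace ℝ E] [NormedSpace 𝕜 E]
    [SMulCommClass ℝ 𝕜 E] : Submodule 𝕜 (Lp E ∞ unitMeasure) where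
  carrier := {v | ∃ g : Lp E ∞ unitMeasure, HasWeakDeriv v g}
  zero_mem' := ⟨0, HasWeakDeriv.zero⟩
  add_mem' := by
    rintro _ _ ⟨g₁, h₁⟩ ⟨g₂, h₂⟩
    exact ⟨g₁ + g₂, h₁.add h₂⟩
  smul_mem' := by
    rintro c _ ⟨g, h⟩
    exact ⟨c • g, h.const_smul c⟩

/-- The elements `v` of `L^∞([0,1], E)` with a representative `u` that is continuous on `[0,1]`
and satisfies `u(1) = B u(0)`. (Every element of `W^{1,∞}([0,1], E)` has exactly one continuous
representative on `[0,1]`, through which its boundary values are defined.) -/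
def boundarySpace (B : E →L[𝕜] E) : Submodule 𝕜 (Lp E ∞ unitMeasure) where
  carrier := {v | ∃ u : ℝ → E, ContinuousOn u (Icc 0 1) ∧ v =ᵐ[unitMeasure] u ∧ u 1 = B (u 0)}
  zero_mem' := ⟨0, continuousOn_const, Lp.coeFn_zero E ∞ unitMeasure, by simp⟩
  add_mem' := by
    rintro v₁ v₂ ⟨u₁, hc₁, he₁, hb₁⟩ ⟨u₂, hc₂, he₂, hb₂⟩
    exact ⟨u₁ + u₂, hc₁.add hc₂, (Lp.coeFn_add v₁ v₂).trans (he₁.add he₂), by simp [hb₁, hb₂]⟩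
  smul_mem' := by
    rintro c v ⟨u, hc, he, hb⟩
    exact ⟨c • u, hc.const_smul c, (Lp.coeFn_smul c v).trans (he.const_smul c), by simp [hb]⟩

/-- The operator `A = d/dx` on `L^∞([0,1], E)` (weak differentiation) with domain
`D(A) = {v ∈ W^{1,∞}([0,1], E) | v(1) = B v(0)}`. -/
def transportOperator [SMulCommClass ℝ 𝕜 E] [CompleteSpace E] (B : E →L[𝕜] E) :
    Lp E ∞ unitMeasure →ₗ.[𝕜] Lp E ∞ unitMeasure where
  domain := sobolev 𝕜 E ⊓ boundarySpace B
  toFun :=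
    { toFun := fun v => Classical.choose v.2.1
      map_add' := fun v₁ v₂ => (Classical.choose_spec (v₁ + v₂).2.1).unique
        ((Classical.choose_spec v₁.2.1).add (Classical.choose_spec v₂.2.1))
      map_smul' := fun c v => (Classical.choose_spec (c • v).2.1).unique
        ((Classical.choose_spec v.2.1).const_smul c) }

/-- `(v, g)` lies in the graph of `A` iff `v` has weak derivative `g` and `v(1) = B v(0)`. -/
theorem mem_graph_transportOperator [SMulCommClass ℝ 𝕜 E] [CompleteSpace E] (B : E →L[𝕜] E)
    (v g : Lp E ∞ unitMeasure) :
    (v, g) ∈ (transportOperator B).graph ↔ HasWeakDeriv v g ∧ v ∈ boundarySpace B := by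
  rw [LinearPMap.mem_graph_iff]
  constructor
  · rintro ⟨y, rfl, rfl⟩
    exact ⟨Classical.choose_spec y.2.1, y.2.2⟩
  · rintro ⟨h, hb⟩
    exact ⟨⟨v, ⟨g, h⟩, hb⟩, rfl, (Classical.choose_spec (⟨g, h⟩ : v ∈ sobolev 𝕜 E)).unique h⟩

end Sobolev

/-! ### Networks -/

/-- A simple, locally finite directed graph with vertex set `V` and edges `e_j`, `j ∈ J`. -/
structure DirectedGraph (V J : Type*) where
  tail : J → V
  head : J → V
  no_loops : ∀ j, tail j ≠ head j
  no_multiple_edges : Function.Injective fun j => (tail j, head j)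
  locallyFinite : ∀ v : V, {j : J | tail j = v ∨ head j = v}.Finite

open Classical in
/-- The weighted (transposed) adjacency matrix `𝔹` of the line graph for the weights `w_ij`:
`𝔹_ij = w_ij` if the head of `e_j` is the tail of `e_i`, and `𝔹_ij = 0` otherwise. -/
def DirectedGraph.lineMatrix {V J : Type*} (G : DirectedGraph V J) (w : J → J → ℝ) :
    Matrix J J ℝ :=
  Matrix.of fun i j => if G.head j = G.tail i then w i j else 0

/-- A network: a simple, locally finite directed graph with weights `0 ≤ w_ij ≤ 1` such that, for
every edge `e_j`, the weights `w_ij` over its successor edges `e_i` sum up to `1`, so that the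
matrix `𝔹` is column stochastic. -/
structure Network (V J : Type*) extends DirectedGraph V J where
  w : J → J → ℝ
  w_nonneg : ∀ i j, 0 ≤ w i j
  w_le_one : ∀ i j, w i j ≤ 1
  column_sum : ∀ j, HasSum (fun i => toDirectedGraph.lineMatrix w i j) 1

namespace Network

variable {V J : Type*} (N : Network V J)

/-- The matrix `𝔹`. -/
def adjMatrix : Matrix J J ℝ := N.toDirectedGraph.lineMatrix N.w

theorem adjMatrix_nonneg (i j : J) : 0 ≤ N.adjMatrix i j := by
  unfold adjMatrix DirectedGraph.lineMatrix
  simp only [Matrix.of_apply]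
  split_ifs
  · exact N.w_nonneg i j
  · exact le_rfl

variable {𝕜 : Type*} [RCLike 𝕜]

theorem summable_norm_coord (x : ℓ¹(J, 𝕜)) : Summable fun j => ‖x j‖ := by
  simpa using (lp.memℓp x).summable (by simp)

theorem summable_adjMatrix_mul_prod (x : ℓ¹(J, 𝕜)) :
    Summable fun p : J × J => N.adjMatrix p.2 p.1 * ‖x p.1‖ := by
  have hcol : ∀ j, HasSum (fun i => N.adjMatrix i j * ‖x j‖) (1 * ‖x j‖) := fun j =>
    (N.column_sum j).mul_right _
  rw [summable_prod_of_nonneg fun p => mul_nonneg (N.adjMatrix_nonneg _ _) (norm_nonneg _)]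
  refine ⟨fun j => (hcol j).summable, ?_⟩
  simp_rw [fun j => (hcol j).tsum_eq, one_mul]
  exact summable_norm_coord x

theorem norm_entry_mul (x : ℓ¹(J, 𝕜)) (i j : J) :
    ‖((N.adjMatrix i j : ℝ) : 𝕜) * x j‖ = N.adjMatrix i j * ‖x j‖ := by
  rw [norm_mul, RCLike.norm_ofReal, abs_of_nonneg (N.adjMatrix_nonneg i j)]

theorem summable_row (x : ℓ¹(J, 𝕜)) (i : J) :
    Summable fun j => ((N.adjMatrix i j : ℝ) : 𝕜) * x j := by
  apply Summable.of_norm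
  simp_rw [N.norm_entry_mul]
  exact (N.summable_adjMatrix_mul_prod x).prod_symm.prod_factor i

theorem norm_row_le (x : ℓ¹(J, 𝕜)) (i : J) :
    ‖∑' j, ((N.adjMatrix i j : ℝ) : 𝕜) * x j‖ ≤ ∑' j, N.adjMatrix i j * ‖x j‖ := by
  have h : Summable fun j => ‖((N.adjMatrix i j : ℝ) : 𝕜) * x j‖ := by
    simp_rw [N.norm_entry_mul]
    exact (N.summable_adjMatrix_mul_prod x).prod_symm.prod_factor i
  refine (norm_tsum_le_tsum_norm h).trans_eq ?_
  simp_rw [N.norm_entry_mul]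

theorem summable_rows (x : ℓ¹(J, 𝕜)) : Summable fun i => ∑' j, N.adjMatrix i j * ‖x j‖ :=
  (N.summable_adjMatrix_mul_prod x).prod_symm.prod

theorem tsum_rows (x : ℓ¹(J, 𝕜)) : ∑' i, ∑' j, N.adjMatrix i j * ‖x j‖ = ‖x‖ := by
  have hcol : ∀ j, HasSum (fun i => N.adjMatrix i j * ‖x j‖) (1 * ‖x j‖) := fun j =>
    (N.column_sum j).mul_right _
  have h : ∑' i, ∑' j, N.adjMatrix i j * ‖x j‖ = ∑' j, ∑' i, N.adjMatrix i j * ‖x j‖ :=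
    Summable.tsum_comm (f := fun j i => N.adjMatrix i j * ‖x j‖) (N.summable_adjMatrix_mul_prod x)
  have hx : ‖x‖ = ∑' j, ‖x j‖ := by
    simpa using lp.norm_eq_tsum_rpow (by simp) x
  rw [h, hx]
  exact tsum_congr fun j => (hcol j).tsum_eq.trans (one_mul _)

theorem memℓp_rows (x : ℓ¹(J, 𝕜)) :
    Memℓp (fun i => ∑' j, ((N.adjMatrix i j : ℝ) : 𝕜) * x j) 1 := by
  apply memℓp_gen
  simp only [ENNReal.toReal_one, Real.rpow_one]
  exact (N.summable_rows x).of_nonneg_of_le (fun _ => norm_nonneg _) (N.norm_row_le x)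

variable (𝕜) in
/-- The bounded operator on `ℓ¹` given by the matrix `𝔹`: `(𝔹 x)_i = ∑_j 𝔹_ij x_j`. -/
def adjOp : ℓ¹(J, 𝕜) →L[𝕜] ℓ¹(J, 𝕜) :=
  LinearMap.mkContinuous
    { toFun := fun x => ⟨fun i => ∑' j, ((N.adjMatrix i j : ℝ) : 𝕜) * x j, N.memℓp_rows x⟩
      map_add' := fun x y => by
        ext i
        simp only [lp.coeFn_add, Pi.add_apply, mul_add]
        exact (N.summable_row x i).tsum_add (N.summable_row y i)
      map_smul' := fun c x => by
        ext i
        simp only [lp.coeFn_smul, Pi.smul_apply, smul_eq_mul, RingHom.id_apply]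
        rw [← tsum_mul_left]
        congr 1
        ext j
        ring } 1 fun x => by
    rw [one_mul]
    refine lp.norm_le_of_tsum_le (by simp) (norm_nonneg x) ?_
    simp only [ENNReal.toReal_one, Real.rpow_one]
    rw [← N.tsum_rows x]
    refine Summable.tsum_le_tsum (N.norm_row_le x) ?_ (N.summable_rows x)
    exact (N.summable_rows x).of_nonneg_of_le (fun _ => norm_nonneg _) (N.norm_row_le x)

end Network

/-! ### The state space and its weak* topology -/

/-- The space `c₀(J)` of families vanishing at infinity, with the supremum norm. -/
def cZero (J 𝕜 : Type*) [RCLike 𝕜] : Submodule 𝕜 ℓ^∞(J, 𝕜) where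
  carrier := {x | Tendsto (fun j => x j) cofinite (𝓝 0)}
  zero_mem' := by simpa using tendsto_const_nhds
  add_mem' := by
    intro x y hx hy
    simpa using Tendsto.add hx hy
  smul_mem' := by
    intro c x hx
    simpa using Tendsto.const_mul c hx

/-- The state space `X = L^∞([0,1], ℓ¹)` with its essential supremum norm. -/
abbrev StateSpace (J 𝕜 : Type*) [RCLike 𝕜] := Lp (ℓ¹(J, 𝕜)) ∞ unitMeasure

/-- The predual `L¹([0,1], c₀)`. -/
abbrev Predual (J 𝕜 : Type*) [RCLike 𝕜] := Lp (cZero J 𝕜) 1 unitMeasure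

/-- The duality pairing `⟨f, g⟩ = ∫₀¹ ∑_j f_j(s) g_j(s) ds` between `L^∞([0,1], ℓ¹)` and
`L¹([0,1], c₀)`. -/
def dualPairing {J 𝕜 : Type*} [RCLike 𝕜] (f : StateSpace J 𝕜) (g : Predual J 𝕜) : 𝕜 :=
  ∫ s in Icc (0 : ℝ) 1, ∑' j, f s j * (g s : ℓ^∞(J, 𝕜)) j

/-- The weak* topology on `X = L^∞([0,1], ℓ¹) = L¹([0,1], c₀)'`: the coarsest topology for which all
functionals `f ↦ ⟨f, g⟩` with `g ∈ L¹([0,1], c₀)` are continuous. -/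
@[reducible]
def weakStarTopology (J 𝕜 : Type*) [RCLike 𝕜] : TopologicalSpace (StateSpace J 𝕜) :=
  ⨅ g : Predual J 𝕜, TopologicalSpace.induced (fun f => dualPairing f g) inferInstance

end

/-!
The idea is to extend a function `f` on `[0,1)` to `[0,∞)` by the rule `F(x + 1) = 𝔹 F(x)`
(`iterExt`). The semigroup is then the left translation of `F`, restricted to `[0,1]`
(`transportSemigroup`): the semigroup law and the contraction property are immediate, and the
boundary condition `v(1) = 𝔹 v(0)` says exactly that the extension of `v` is continuous.

*Continuity.* Since every edge has only finitely many predecessors, the transposed matrix maps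
`c₀` to itself (`Network.preadjOp`), and therefore every `T(t)` is the adjoint of an operator on
`L¹([0,1], c₀)`, which is a translation of the same kind in the opposite direction
(`setIntegral_pairing_iterExt`, `preadjointSemigroup`). Translations are strongly continuous in
`L¹`, so that the modulus of continuity of `t ↦ ⟨T(t) f, g⟩` depends only on `g` and `‖f‖`. This
gives strong continuity and local bi-equicontinuity at once
(`isBiContSemigroup_transportSemigroup`).

*Generator.* If `v' = g` weakly and `v(1) = 𝔹 v(0)`, then by the lemma of du Bois-Reymond the
extension of `v` is a primitive of the extension of `g`. The difference quotients of the orbit are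
averages of the latter, hence bounded, and they converge by Lebesgue's differentiation theorem.
Conversely, the weak* limit of the difference quotients is the weak derivative, as is seen by moving
the translation to a test function. The extension has a jump `𝔹 v(0) - v(1)` at `1`, and bounded
difference quotients exclude a nonzero jump (`mem_boundarySpace_of_norm_le`).

*Topology.* That bounded weak* Cauchy sequences converge is the duality
`L¹([0,1], c₀)' = L^∞([0,1], ℓ¹)` (`IsCoordinatePairing.exists_intervalPairing_eq`). Each
coordinate of the representing function comes from the Fréchet–Riesz theorem in `L²([0,1])`, and
testing with sign functions shows that the coordinates are absolutely summable almost everywhere,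
with the right bound (`ae_sum_norm_le_norm`). The same estimate shows that the predual is norming.

The arguments are formulated for a pairing `b : E × F → 𝕜` of Banach spaces with respect to which a
contraction `B` on `E` has a preadjoint; the few properties of `ℓ¹` and `c₀` that the last part
needs are collected in `IsCoordinatePairing`.
-/

noncomputable section

/-! ### Extension of a function on the unit interval by iterating an operator -/

section IterExt

variable {𝕜 E : Type*} [RCLike 𝕜] [NormedAddCommGroup E] [NormedSpace 𝕜 E]

/-- The extension of `f : [0,1) → E` to `[0,∞)` with `F(x + 1) = B F(x)`, that is,
`F(x) = B^n f(x - n)` for `n ≤ x < n + 1`. Only its values at `x ≥ 0` are meaningful. -/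
def iterExt (B : E →L[𝕜] E) (f : ℝ → E) (x : ℝ) : E := (B ^ ⌊x⌋₊) (f (Int.fract x))

theorem iterExt_eq (B : E →L[𝕜] E) (f : ℝ → E) {x : ℝ} {n : ℕ} (h₁ : (n : ℝ) ≤ x)
    (h₂ : x < n + 1) : iterExt B f x = (B ^ n) (f (x - n)) := by
  have hn : ⌊x⌋ = n := Int.floor_eq_iff.2 ⟨by exact_mod_cast h₁, by exact_mod_cast h₂⟩
  have hn' : ⌊x⌋₊ = n := by rw [← Int.floor_toNat, hn, Int.toNat_natCast]
  rw [iterExt, hn', Int.fract, hn, Int.cast_natCast]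

theorem iterExt_of_mem_Ico (B : E →L[𝕜] E) (f : ℝ → E) {x : ℝ} (hx : x ∈ Ico (0 : ℝ) 1) :
    iterExt B f x = f x := by
  simpa using iterExt_eq B f (n := 0) (by simpa using hx.1) (by simpa using hx.2)

theorem norm_iterExt_le {B : E →L[𝕜] E} (hB : ‖B‖ ≤ 1) (f : ℝ → E) (x : ℝ) :
    ‖iterExt B f x‖ ≤ ‖f (Int.fract x)‖ := by
  have hpow : ‖B ^ ⌊x⌋₊‖ ≤ 1 := by
    rcases Nat.eq_zero_or_pos ⌊x⌋₊ with h | h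
    · rw [h, pow_zero]
      exact ContinuousLinearMap.norm_id_le
    · exact (norm_pow_le' B h).trans (pow_le_one₀ (norm_nonneg _) hB)
  calc ‖iterExt B f x‖ ≤ ‖B ^ ⌊x⌋₊‖ * ‖f (Int.fract x)‖ := ContinuousLinearMap.le_opNorm _ _
    _ ≤ 1 * ‖f (Int.fract x)‖ := by gcongr
    _ = _ := one_mul _

/-- Extending commutes with nonnegative shifts; this is the semigroup law. -/
theorem iterExt_iterExt_add (B : E →L[𝕜] E) (f : ℝ → E) {s x : ℝ} (hs : 0 ≤ s) (hx : 0 ≤ x) :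
    iterExt B (fun y => iterExt B f (s + y)) x = iterExt B f (s + x) := by
  have hfl : s + x = (s + Int.fract x) + (⌊x⌋₊ : ℕ) := by
    have h₁ := Int.floor_add_fract x
    have h₂ : ((⌊x⌋₊ : ℕ) : ℝ) = (⌊x⌋ : ℝ) := by
      rw [natCast_floor_eq_intCast_floor hx]
    rw [h₂]
    linarith
  have h0 : 0 ≤ s + Int.fract x := add_nonneg hs (Int.fract_nonneg x)
  rw [iterExt, iterExt, iterExt, hfl, Nat.floor_add_natCast h0, Int.fract_add_natCast,
    add_comm ⌊s + Int.fract x⌋₊, pow_add]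
  rfl

theorem ae_unitMeasure_mem : ∀ᵐ s ∂unitMeasure, s ∈ Icc (0 : ℝ) 1 :=
  ae_restrict_mem measurableSet_Icc

theorem ae_unitMeasure_mem_Ioo : ∀ᵐ s ∂unitMeasure, s ∈ Ioo (0 : ℝ) 1 := by
  rw [show unitMeasure = volume.restrict (Ioo (0 : ℝ) 1) from
    (Measure.restrict_congr_set Ioo_ae_eq_Icc).symm]
  exact ae_restrict_mem measurableSet_Ioo

theorem quasiMeasurePreserving_fract :
    Measure.QuasiMeasurePreserving (Int.fract : ℝ → ℝ) volume unitMeasure := by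
  refine ⟨measurable_fract, ?_⟩
  refine Measure.AbsolutelyContinuous.mk fun s hs h0 => ?_
  rw [Measure.map_apply measurable_fract hs]
  rw [Measure.restrict_apply hs] at h0
  have hsub : (Int.fract : ℝ → ℝ) ⁻¹' s ⊆ ⋃ k : ℤ, (fun x : ℝ => x - k) ⁻¹' (s ∩ Icc 0 1) := by
    intro x hx
    rw [mem_iUnion]
    exact ⟨⌊x⌋, hx, Int.fract_nonneg x, (Int.fract_lt_one x).le⟩
  refine measure_mono_null hsub ((measure_iUnion_null_iff).2 fun k => ?_)
  simp_rw [sub_eq_add_neg]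
  rw [measure_preimage_add_right, h0]

theorem quasiMeasurePreserving_shift (t : ℝ) :
    Measure.QuasiMeasurePreserving (fun s : ℝ => t + s) unitMeasure volume :=
  ((measurePreserving_add_left volume t).quasiMeasurePreserving).mono_left
    Measure.restrict_le_self.absolutelyContinuous

theorem quasiMeasurePreserving_reflect (t : ℝ) :
    Measure.QuasiMeasurePreserving (fun s : ℝ => t + 1 - s) unitMeasure volume :=
  ((Measure.measurePreserving_sub_left volume (t + 1)).quasiMeasurePreserving).mono_left
    Measure.restrict_le_self.absolutelyContinuous

theorem measurePreserving_one_sub :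
    MeasurePreserving (fun s : ℝ => 1 - s) unitMeasure unitMeasure := by
  have h := (Measure.measurePreserving_sub_left (volume : Measure ℝ) 1).restrict_preimage
    (s := Icc (0 : ℝ) 1) measurableSet_Icc
  have hpre : (fun s : ℝ => 1 - s) ⁻¹' Icc (0 : ℝ) 1 = Icc 0 1 := by
    ext x
    simp only [mem_preimage, mem_Icc]
    constructor <;> rintro ⟨h₁, h₂⟩ <;> constructor <;> linarith
  rwa [hpre] at h

theorem iterExt_congr_ae (B : E →L[𝕜] E) {f f' : ℝ → E} (h : f =ᵐ[unitMeasure] f') :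
    iterExt B f =ᵐ[volume] iterExt B f' := by
  filter_upwards [quasiMeasurePreserving_fract.ae h] with x hx
  rw [iterExt, iterExt, hx]

theorem aestronglyMeasurable_iterExt (B : E →L[𝕜] E) {f : ℝ → E}
    (hf : AEStronglyMeasurable f unitMeasure) : AEStronglyMeasurable (iterExt B f) volume := by
  have hcov : (volume : Measure ℝ)
      = volume.restrict (⋃ n : ℕ, (fun x : ℝ => ⌊x⌋₊) ⁻¹' {n}) := by
    rw [← preimage_iUnion, iUnion_of_singleton, preimage_univ, Measure.restrict_univ]
  rw [hcov]
  refine AEStronglyMeasurable.iUnion fun n => ?_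
  have hm : MeasurableSet ((fun x : ℝ => ⌊x⌋₊) ⁻¹' {n}) :=
    Nat.measurable_floor (measurableSet_singleton n)
  have h1 : AEStronglyMeasurable (fun x => (B ^ n) (f (Int.fract x))) volume :=
    (B ^ n).continuous.comp_aestronglyMeasurable
      (hf.comp_quasiMeasurePreserving quasiMeasurePreserving_fract)
  refine h1.restrict.congr ?_
  filter_upwards [ae_restrict_mem hm] with x hx
  have : ⌊x⌋₊ = n := hx
  rw [iterExt, this]

theorem intervalIntegrable_iterExt {B : E →L[𝕜] E} (hB : ‖B‖ ≤ 1) {f : ℝ → E}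
    (hf : Integrable f unitMeasure) (a b : ℝ) : IntervalIntegrable (iterExt B f) volume a b := by
  have hper : Function.Periodic (fun x => ‖f (Int.fract x)‖) 1 := fun x => by
    simp only [Int.fract_add_one]
  have h01 : IntervalIntegrable (fun x => ‖f (Int.fract x)‖) volume 0 (0 + 1) := by
    rw [zero_add, intervalIntegrable_iff_integrableOn_Ico_of_le zero_le_one]
    have : IntegrableOn f (Ico (0 : ℝ) 1) := IntegrableOn.mono_set hf Ico_subset_Icc_self
    refine IntegrableOn.congr_fun (f := fun x => ‖f x‖) this.norm (fun x hx => ?_) measurableSet_Ico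
    simp only [Int.fract_eq_self.2 hx]
  refine (hper.intervalIntegrable one_ne_zero h01 a b).mono_fun'
    (aestronglyMeasurable_iterExt B hf.1).restrict (Eventually.of_forall fun x => ?_)
  exact norm_iterExt_le hB f x

end IterExt

/-! ### The semigroup on `L^∞([0,1], E)` -/

section Semigroup

variable {𝕜 E : Type*} [RCLike 𝕜] [NormedAddCommGroup E] [NormedSpace 𝕜 E]

theorem ae_norm_coeFn_le_norm (f : Lp E ∞ unitMeasure) : ∀ᵐ s ∂unitMeasure, ‖f s‖ ≤ ‖f‖ := by
  have h := ae_le_eLpNormEssSup (f := f) (μ := unitMeasure)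
  filter_upwards [h] with s hs
  rw [Lp.norm_def, eLpNorm_exponent_top]
  have hfin : eLpNormEssSup f unitMeasure ≠ ⊤ := by
    rw [← eLpNorm_exponent_top]
    exact Lp.eLpNorm_ne_top f
  rw [← toReal_enorm]
  exact ENNReal.toReal_mono hfin hs

theorem norm_le_of_ae_norm_le {f : Lp E ∞ unitMeasure} {C : ℝ} (hC : 0 ≤ C)
    (h : ∀ᵐ s ∂unitMeasure, ‖f s‖ ≤ C) : ‖f‖ ≤ C := by
  simpa using Lp.norm_le_of_ae_bound hC h

theorem ae_norm_iterExt_le {B : E →L[𝕜] E} (hB : ‖B‖ ≤ 1) (f : Lp E ∞ unitMeasure) :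
    ∀ᵐ x : ℝ, ‖iterExt B f x‖ ≤ ‖f‖ := by
  filter_upwards [quasiMeasurePreserving_fract.ae (ae_norm_coeFn_le_norm f)] with x hx
  exact (norm_iterExt_le hB f x).trans hx

theorem memLp_iterExt_shift {B : E →L[𝕜] E} (hB : ‖B‖ ≤ 1) (f : Lp E ∞ unitMeasure) (t : ℝ) :
    MemLp (fun s => iterExt B f (t + s)) ∞ unitMeasure :=
  memLp_top_of_bound ((aestronglyMeasurable_iterExt B
    (Lp.aestronglyMeasurable f)).comp_quasiMeasurePreserving (quasiMeasurePreserving_shift t)) ‖f‖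
    ((quasiMeasurePreserving_shift t).ae (ae_norm_iterExt_le hB f))

/-- The operators `(T(t) f)(s) = B^n f(t + s - n)`, `n ≤ t + s < n + 1`, on `L^∞([0,1], E)`. -/
def transportSemigroup (B : E →L[𝕜] E) (hB : ‖B‖ ≤ 1) (t : ℝ≥0) :
    BoundedOp 𝕜 (Lp E ∞ unitMeasure) :=
  LinearMap.mkContinuous
    { toFun := fun f => (memLp_iterExt_shift hB f t).toLp
      map_add' := fun f g => by
        rw [← MemLp.toLp_add]
        refine MemLp.toLp_congr _ _ ?_
        refine (quasiMeasurePreserving_shift t).ae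
          (p := fun x => iterExt B (f + g : Lp E ∞ unitMeasure) x
            = iterExt B f x + iterExt B g x) ?_
        filter_upwards [iterExt_congr_ae B (Lp.coeFn_add f g)] with x hx
        rw [hx, iterExt, iterExt, iterExt, Pi.add_apply, map_add]
      map_smul' := fun c f => by
        rw [← MemLp.toLp_const_smul]
        refine MemLp.toLp_congr _ _ ?_
        refine (quasiMeasurePreserving_shift t).ae
          (p := fun x => iterExt B (c • f : Lp E ∞ unitMeasure) x = c • iterExt B f x) ?_
        filter_upwards [iterExt_congr_ae B (Lp.coeFn_smul c f)] with x hx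
        rw [hx, iterExt, iterExt, Pi.smul_apply, map_smul] } 1 fun f => by
    rw [one_mul]
    refine norm_le_of_ae_norm_le (norm_nonneg f) ?_
    filter_upwards [MemLp.coeFn_toLp (memLp_iterExt_shift hB f t),
      (quasiMeasurePreserving_shift t).ae (ae_norm_iterExt_le hB f)] with s hs hs'
    simp only [LinearMap.coe_mk, AddHom.coe_mk]
    rw [hs]
    exact hs'

theorem coeFn_transportSemigroup {B : E →L[𝕜] E} (hB : ‖B‖ ≤ 1) (t : ℝ≥0)
    (f : Lp E ∞ unitMeasure) :
    transportSemigroup B hB t f =ᵐ[unitMeasure] fun s => iterExt B f (t + s) :=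
  MemLp.coeFn_toLp (memLp_iterExt_shift hB f t)

theorem norm_transportSemigroup_le {B : E →L[𝕜] E} (hB : ‖B‖ ≤ 1) (t : ℝ≥0) :
    ‖transportSemigroup B hB t‖ ≤ 1 :=
  LinearMap.mkContinuous_norm_le _ zero_le_one _

theorem norm_transportSemigroup_apply_le {B : E →L[𝕜] E} (hB : ‖B‖ ≤ 1) (t : ℝ≥0)
    (f : Lp E ∞ unitMeasure) : ‖transportSemigroup B hB t f‖ ≤ ‖f‖ := by
  simpa using (transportSemigroup B hB t).le_of_opNorm_le (norm_transportSemigroup_le hB t) f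

theorem transportSemigroup_zero {B : E →L[𝕜] E} (hB : ‖B‖ ≤ 1) (f : Lp E ∞ unitMeasure) :
    transportSemigroup B hB 0 f = f := by
  refine Lp.ext ?_
  filter_upwards [coeFn_transportSemigroup hB 0 f, ae_unitMeasure_mem_Ioo] with s hs hs'
  rw [hs, NNReal.coe_zero, zero_add, iterExt_of_mem_Ico B f ⟨hs'.1.le, hs'.2⟩]

theorem transportSemigroup_add {B : E →L[𝕜] E} (hB : ‖B‖ ≤ 1) (t s : ℝ≥0)
    (f : Lp E ∞ unitMeasure) :
    transportSemigroup B hB (t + s) f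
      = transportSemigroup B hB t (transportSemigroup B hB s f) := by
  refine Lp.ext ?_
  filter_upwards [coeFn_transportSemigroup hB (t + s) f,
    coeFn_transportSemigroup hB t (transportSemigroup B hB s f),
    (quasiMeasurePreserving_shift t).ae (iterExt_congr_ae B (coeFn_transportSemigroup hB s f)),
    ae_unitMeasure_mem] with x h₁ h₂ h₃ hx
  rw [h₁, h₂, h₃, iterExt_iterExt_add B f s.coe_nonneg (add_nonneg t.coe_nonneg hx.1),
    NNReal.coe_add]
  congr 1
  ring

end Semigroup

/-! ### The preadjoint semigroup on `L¹([0,1], F)` -/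

section Preadjoint

variable {𝕜 E F : Type*} [RCLike 𝕜] [NormedAddCommGroup E] [NormedSpace 𝕜 E]
  [NormedAddCommGroup F] [NormedSpace 𝕜 F]

theorem pairing_pow {b : E →L[𝕜] F →L[𝕜] 𝕜} {B : E →L[𝕜] E} {B' : F →L[𝕜] F}
    (h : ∀ x y, b (B x) y = b x (B' y)) (n : ℕ) (x : E) (y : F) :
    b ((B ^ n) x) y = b x ((B' ^ n) y) := by
  induction n generalizing x with
  | zero => rfl
  | succ n ih =>
    rw [pow_succ, pow_succ', mul_apply_eq_comp, mul_apply_eq_comp, ih, h]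

/-- If `B'` is adjoint to `B`, the operator adjoint to `f ↦ iterExt B f (t + ·)` is the same kind of
operator for `B'` after reflecting the interval at its midpoint. -/
theorem setIntegral_pairing_iterExt {b : E →L[𝕜] F →L[𝕜] 𝕜} {B : E →L[𝕜] E} {B' : F →L[𝕜] F}
    (h : ∀ x y, b (B x) y = b x (B' y)) (t : ℝ≥0) (f : ℝ → E) (g : ℝ → F) :
    ∫ s in Icc (0 : ℝ) 1, b (iterExt B f (t + s)) (g s)
      = ∫ x in Icc (0 : ℝ) 1, b (f x) (iterExt B' (fun y => g (1 - y)) (t + 1 - x)) := by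
  set P : ℝ → 𝕜 := fun s => b (iterExt B f (t + s)) (g s) with hP
  have hper : Function.Periodic (fun y => P (Int.fract y)) 1 := fun y => by
    simp only [Int.fract_add_one]
  calc ∫ s in Icc (0 : ℝ) 1, P s = ∫ s in Icc (0 : ℝ) 1, P (Int.fract s) := by
        apply integral_congr_ae
        filter_upwards [ae_unitMeasure_mem_Ioo] with s hs
        rw [Int.fract_eq_self.2 ⟨hs.1.le, hs.2⟩]
    _ = ∫ s in (0 : ℝ)..0 + 1, P (Int.fract s) := by
        rw [zero_add, intervalIntegral.integral_of_le zero_le_one, integral_Icc_eq_integral_Ioc]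
    _ = ∫ s in (0 - (t : ℝ))..(0 - (t : ℝ)) + 1, P (Int.fract s) :=
        hper.intervalIntegral_add_eq _ _
    _ = ∫ x in (0 : ℝ)..1, P (Int.fract (x - t)) := by
        rw [intervalIntegral.integral_comp_sub_right (fun y => P (Int.fract y)) (t : ℝ)]
        congr 1
        ring
    _ = ∫ x in Icc (0 : ℝ) 1, P (Int.fract (x - t)) := by
        rw [intervalIntegral.integral_of_le zero_le_one, integral_Icc_eq_integral_Ioc]
    _ = _ := by
        apply integral_congr_ae
        have hZ : ∀ᵐ x ∂unitMeasure, x ∉ range (fun n : ℤ => (n : ℝ) + t) :=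
          ae_restrict_of_ae ((countable_range _).ae_notMem _)
        filter_upwards [ae_unitMeasure_mem_Ioo, hZ] with x hx hxZ
        -- `x` lies in the image of the point `s` of the interval that is moved to `x + n`
        set s := Int.fract (x - t) with hs
        have hs0 : 0 < s := by
          refine lt_of_le_of_ne (Int.fract_nonneg _) fun h0 => hxZ ⟨⌊x - t⌋, ?_⟩
          have := Int.floor_add_fract (x - t)
          rw [← hs, ← h0] at this
          simp only
          linarith
        have hs1 : s < 1 := Int.fract_lt_one _
        have hfl : ⌊x - t⌋ ≤ 0 := by
          have : ⌊x - t⌋ < 1 := Int.floor_lt.2 (by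
            have := t.2
            push_cast
            linarith [hx.2])
          omega
        obtain ⟨n, hn⟩ := Int.eq_ofNat_of_zero_le (neg_nonneg.2 hfl)
        have hxt : x - t = s - n := by
          have h₁ := Int.floor_add_fract (x - t)
          have h₂ : (⌊x - t⌋ : ℝ) = -(n : ℝ) := by
            have : ⌊x - t⌋ = -(n : ℤ) := by omega
            rw [this]
            push_cast
            rfl
          rw [h₂] at h₁
          linarith
        have e₁ : iterExt B f (t + s) = (B ^ n) (f x) := by
          rw [iterExt_eq B f (n := n) (by linarith [hx.1]) (by linarith [hx.2])]
          congr 2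
          linarith
        have e₂ : iterExt B' (fun y => g (1 - y)) (t + 1 - x) = (B' ^ n) (g s) := by
          rw [iterExt_eq B' _ (n := n) (by linarith) (by linarith)]
          congr 2
          linarith
        rw [hP]
        simp only
        rw [e₁, e₂, pairing_pow h]

theorem integrable_iterExt_reflect {B' : F →L[𝕜] F} (hB' : ‖B'‖ ≤ 1) {g : ℝ → F}
    (hg : Integrable g unitMeasure) (t : ℝ) :
    Integrable (fun x => iterExt B' (fun y => g (1 - y)) (t + 1 - x)) unitMeasure := by
  have h := intervalIntegrable_iterExt hB'
    (measurePreserving_one_sub.integrable_comp_of_integrable hg) (t + 1 - 0) (t + 1 - 1)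
  have h' := h.comp_sub_left (t + 1)
  simp only [sub_sub_cancel] at h'
  rw [intervalIntegrable_iff_integrableOn_Icc_of_le zero_le_one] at h'
  exact h'

/-- The preadjoint of `transportSemigroup`, as a family of maps on `L¹([0,1], F)`. -/
def preadjointSemigroup (B' : F →L[𝕜] F) (hB' : ‖B'‖ ≤ 1) (t : ℝ≥0) (g : Lp F 1 unitMeasure) :
    Lp F 1 unitMeasure :=
  (integrable_iterExt_reflect hB' (L1.integrable_coeFn g) t).toL1 _

theorem coeFn_preadjointSemigroup {B' : F →L[𝕜] F} (hB' : ‖B'‖ ≤ 1) (t : ℝ≥0)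
    (g : Lp F 1 unitMeasure) : preadjointSemigroup B' hB' t g =ᵐ[unitMeasure]
      fun x => iterExt B' (fun y => g (1 - y)) (t + 1 - x) :=
  Integrable.coeFn_toL1 _

theorem tendsto_integral_norm_translate {H : ℝ → F} (hH : Integrable H) :
    Tendsto (fun t : ℝ => ∫ y, ‖H (t + y) - H y‖) (𝓝 0) (𝓝 0) := by
  have hmp : ∀ t : ℝ, MeasurePreserving (fun y : ℝ => t + y) volume volume :=
    fun t => measurePreserving_add_left volume t
  have hcont : Tendsto (fun t : ℝ => (⟨fun y => t + y, by fun_prop⟩ : C(ℝ, ℝ))) (𝓝 0)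
      (𝓝 ⟨fun y => 0 + y, by fun_prop⟩) := by
    have : Continuous (fun t : ℝ => (⟨fun y => t + y, by fun_prop⟩ : C(ℝ, ℝ))) :=
      ContinuousMap.continuous_of_continuous_uncurry _ (by
        simp only [Function.uncurry_def, ContinuousMap.coe_mk]
        fun_prop)
    exact this.tendsto 0
  have h := Filter.Tendsto.compMeasurePreservingLp (E := F) (p := 1)
    (tendsto_const_nhds (x := hH.toL1 H)) hcont hmp (hmp 0) ENNReal.one_ne_top
  have h2 := tendsto_iff_norm_sub_tendsto_zero.1 h
  refine h2.congr fun t => ?_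
  rw [L1.norm_eq_integral_norm]
  apply integral_congr_ae
  filter_upwards [Lp.coeFn_sub (Lp.compMeasurePreserving _ (hmp t) (hH.toL1 H))
      (Lp.compMeasurePreserving _ (hmp 0) (hH.toL1 H)),
    Lp.coeFn_compMeasurePreserving (hH.toL1 H) (hmp t),
    Lp.coeFn_compMeasurePreserving (hH.toL1 H) (hmp 0),
    (hmp t).quasiMeasurePreserving.ae hH.coeFn_toL1, hH.coeFn_toL1] with y h₁ h₂ h₃ h₄ h₅
  simp only [ContinuousMap.coe_mk]
  rw [h₁, Pi.sub_apply, h₂, h₃, Function.comp_apply, Function.comp_apply, h₄, zero_add, h₅]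

/-- The preadjoint semigroup is strongly continuous at `0`, because translations are continuous in
`L¹(ℝ, F)`. -/
theorem tendsto_norm_preadjointSemigroup_sub {B' : F →L[𝕜] F} (hB' : ‖B'‖ ≤ 1)
    (g : Lp F 1 unitMeasure) :
    Tendsto (fun t : ℝ≥0 => ‖preadjointSemigroup B' hB' t g - g‖) (𝓝 0) (𝓝 0) := by
  set G : ℝ → F := iterExt B' (fun y => g (1 - y)) with hG
  set H : ℝ → F := (Icc (0 : ℝ) 2).indicator G with hH
  have hint : Integrable H := by
    rw [hH, integrable_indicator_iff measurableSet_Icc,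
      ← intervalIntegrable_iff_integrableOn_Icc_of_le zero_le_two]
    exact intervalIntegrable_iterExt hB'
      (measurePreserving_one_sub.integrable_comp_of_integrable (L1.integrable_coeFn g)) _ _
  have hlim : Tendsto (fun t : ℝ≥0 => ∫ y, ‖H (t + y) - H y‖) (𝓝 0) (𝓝 0) :=
    (tendsto_integral_norm_translate hint).comp
      (by simpa using (NNReal.continuous_coe.tendsto 0))
  refine squeeze_zero' (Eventually.of_forall fun _ => norm_nonneg _) ?_ hlim
  have h1 : ∀ᶠ t : ℝ≥0 in 𝓝 0, t ≤ 1 := by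
    filter_upwards [Iio_mem_nhds (zero_lt_one' ℝ≥0)] with t ht using le_of_lt ht
  filter_upwards [h1] with t ht
  have ht' : (t : ℝ) ≤ 1 := by exact_mod_cast ht
  have hint2 : Integrable (fun y => ‖H (t + y) - H y‖) :=
    ((hint.comp_add_left (t : ℝ)).sub hint).norm
  calc ‖preadjointSemigroup B' hB' t g - g‖
      = ∫ x in Icc (0 : ℝ) 1, ‖H (t + (1 - x)) - H (1 - x)‖ := by
        rw [L1.norm_eq_integral_norm]
        apply integral_congr_ae
        filter_upwards [Lp.coeFn_sub (preadjointSemigroup B' hB' t g) g,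
          coeFn_preadjointSemigroup hB' t g, ae_unitMeasure_mem_Ioo] with x h₁ h₂ hx
        have m₁ : (t : ℝ) + 1 - x ∈ Icc (0 : ℝ) 2 :=
          ⟨by linarith [t.2, hx.2, show (0 : ℝ) ≤ t from t.2], by linarith [hx.1]⟩
        have m₂ : 1 - x ∈ Icc (0 : ℝ) 2 := ⟨by linarith [hx.2], by linarith [hx.1]⟩
        rw [h₁, Pi.sub_apply, h₂, ← add_sub_assoc, hH, indicator_of_mem m₁, indicator_of_mem m₂,
          hG, iterExt_of_mem_Ico B' _ (x := 1 - x) ⟨by linarith [hx.2], by linarith [hx.1]⟩,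
          sub_sub_cancel]
    _ = ∫ y in Icc (0 : ℝ) 1, ‖H (t + y) - H y‖ :=
        measurePreserving_one_sub.integral_comp
          (Homeomorph.subLeft (1 : ℝ)).measurableEmbedding (fun y => ‖H (t + y) - H y‖)
    _ ≤ ∫ y, ‖H (t + y) - H y‖ :=
        setIntegral_le_integral hint2 (Eventually.of_forall fun _ => norm_nonneg _)

end Preadjoint

/-! ### The duality between `ℓ¹` and `c₀` -/

section Duality

variable {𝕜 J : Type*} [RCLike 𝕜]

-- The inherited structures of `c₀`, repeated here as shortcuts for instance search.

instance cZero.instNormedAddCommGroup : NormedAddCommGroup (cZero J 𝕜) := inferInstance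

instance cZero.instSeminormedAddCommGroup : SeminormedAddCommGroup (cZero J 𝕜) := inferInstance

instance cZero.instNorm : Norm (cZero J 𝕜) := inferInstance

instance cZero.instNormedSpace : NormedSpace 𝕜 (cZero J 𝕜) := inferInstance

theorem norm_eq_tsum_norm (x : ℓ¹(J, 𝕜)) : ‖x‖ = ∑' j, ‖x j‖ := by
  simpa using lp.norm_eq_tsum_rpow (by simp) x

theorem norm_cZero_apply_le (y : cZero J 𝕜) (j : J) : ‖(y : ℓ^∞(J, 𝕜)) j‖ ≤ ‖y‖ :=
  lp.norm_apply_le_norm ENNReal.top_ne_zero (y : ℓ^∞(J, 𝕜)) j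

theorem norm_cZero_le {y : cZero J 𝕜} {C : ℝ} (hC : 0 ≤ C)
    (h : ∀ j, ‖(y : ℓ^∞(J, 𝕜)) j‖ ≤ C) : ‖y‖ ≤ C :=
  lp.norm_le_of_forall_le (f := (y : ℓ^∞(J, 𝕜))) hC h

theorem norm_mul_cZero_le (x : ℓ¹(J, 𝕜)) (y : cZero J 𝕜) (j : J) :
    ‖x j * (y : ℓ^∞(J, 𝕜)) j‖ ≤ ‖x j‖ * ‖y‖ := by
  rw [norm_mul]
  exact mul_le_mul_of_nonneg_left (norm_cZero_apply_le y j) (norm_nonneg _)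

theorem summable_norm_mul_cZero (x : ℓ¹(J, 𝕜)) (y : cZero J 𝕜) :
    Summable fun j => ‖x j * (y : ℓ^∞(J, 𝕜)) j‖ :=
  ((Network.summable_norm_coord x).mul_right ‖y‖).of_nonneg_of_le (fun _ => norm_nonneg _)
    (norm_mul_cZero_le x y)

theorem summable_mul_cZero (x : ℓ¹(J, 𝕜)) (y : cZero J 𝕜) :
    Summable fun j => x j * (y : ℓ^∞(J, 𝕜)) j :=
  (summable_norm_mul_cZero x y).of_norm

theorem norm_tsum_mul_cZero_le (x : ℓ¹(J, 𝕜)) (y : cZero J 𝕜) :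
    ‖∑' j, x j * (y : ℓ^∞(J, 𝕜)) j‖ ≤ ‖x‖ * ‖y‖ := by
  refine (norm_tsum_le_tsum_norm (summable_norm_mul_cZero x y)).trans ?_
  rw [norm_eq_tsum_norm, ← tsum_mul_right]
  exact (summable_norm_mul_cZero x y).tsum_le_tsum (norm_mul_cZero_le x y)
    ((Network.summable_norm_coord x).mul_right ‖y‖)

variable (J 𝕜) in
/-- The pairing `(x, y) ↦ ∑_j x_j y_j` of `ℓ¹` and `c₀`. -/
def sumPairing : ℓ¹(J, 𝕜) →L[𝕜] cZero J 𝕜 →L[𝕜] 𝕜 :=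
  LinearMap.mkContinuous₂
    (LinearMap.mk₂ 𝕜 (fun x y => ∑' j, x j * (y : ℓ^∞(J, 𝕜)) j)
      (fun x₁ x₂ y => by
        rw [← (summable_mul_cZero x₁ y).tsum_add (summable_mul_cZero x₂ y)]
        exact tsum_congr fun j => by rw [lp.coeFn_add, Pi.add_apply, add_mul])
      (fun c x y => by
        rw [smul_eq_mul, ← tsum_mul_left]
        exact tsum_congr fun j => by rw [lp.coeFn_smul, Pi.smul_apply, smul_eq_mul, mul_assoc])
      (fun x y₁ y₂ => by
        rw [← (summable_mul_cZero x y₁).tsum_add (summable_mul_cZero x y₂)]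
        exact tsum_congr fun j => by
          rw [Submodule.coe_add, lp.coeFn_add, Pi.add_apply, mul_add])
      (fun c x y => by
        rw [smul_eq_mul, ← tsum_mul_left]
        exact tsum_congr fun j => by
          rw [Submodule.coe_smul, lp.coeFn_smul, Pi.smul_apply, smul_eq_mul, mul_left_comm]))
    1 fun x y => by
      rw [one_mul]
      exact norm_tsum_mul_cZero_le x y

theorem sumPairing_apply (x : ℓ¹(J, 𝕜)) (y : cZero J 𝕜) :
    sumPairing 𝕜 J x y = ∑' j, x j * (y : ℓ^∞(J, 𝕜)) j := rfl

theorem norm_sumPairing_le (x : ℓ¹(J, 𝕜)) (y : cZero J 𝕜) : ‖sumPairing 𝕜 J x y‖ ≤ ‖x‖ * ‖y‖ :=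
  norm_tsum_mul_cZero_le x y

open Classical in
variable (𝕜) in
/-- The unit vector `e_j` of `c₀`. -/
def cSingle (j : J) : cZero J 𝕜 :=
  ⟨lp.single ∞ j (1 : 𝕜), by
    refine tendsto_const_nhds.congr' ?_
    filter_upwards [(finite_singleton j).compl_mem_cofinite] with i hi
    rw [lp.single_apply_ne _ _ _ (by simpa using hi)]⟩

theorem cSingle_apply_self (j : J) : (cSingle 𝕜 j : ℓ^∞(J, 𝕜)) j = 1 := by
  classical
  exact lp.single_apply_self _ _ _

theorem cSingle_apply_ne {i j : J} (h : i ≠ j) : (cSingle 𝕜 j : ℓ^∞(J, 𝕜)) i = 0 := by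
  classical
  exact lp.single_apply_ne _ _ _ h

theorem sumPairing_cSingle (x : ℓ¹(J, 𝕜)) (j : J) : sumPairing 𝕜 J x (cSingle 𝕜 j) = x j := by
  rw [sumPairing_apply, tsum_eq_single j fun i hi => by rw [cSingle_apply_ne hi, mul_zero],
    cSingle_apply_self, mul_one]

theorem sum_smul_cSingle_apply [DecidableEq J] (F : Finset J) (a : J → 𝕜) (i : J) :
    ((∑ j ∈ F, a j • cSingle 𝕜 j : cZero J 𝕜) : ℓ^∞(J, 𝕜)) i = if i ∈ F then a i else 0 := by
  have h : ((∑ j ∈ F, a j • cSingle 𝕜 j : cZero J 𝕜) : ℓ^∞(J, 𝕜)) i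
      = ∑ j ∈ F, a j * (cSingle 𝕜 j : ℓ^∞(J, 𝕜)) i := by
    rw [Submodule.coe_sum, lp.coeFn_sum, Finset.sum_apply]
    rfl
  rw [h]
  split_ifs with hi
  · rw [Finset.sum_eq_single_of_mem i hi fun j _ hj => by
      rw [cSingle_apply_ne hj.symm, mul_zero], cSingle_apply_self, mul_one]
  · exact Finset.sum_eq_zero fun j hj => by
      rw [cSingle_apply_ne (ne_of_mem_of_not_mem hj hi).symm, mul_zero]

/-- The finitely supported families are dense in `c₀`. -/
theorem hasSum_smul_cSingle (y : cZero J 𝕜) :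
    HasSum (fun j => (y : ℓ^∞(J, 𝕜)) j • cSingle 𝕜 j) y := by
  classical
  rw [HasSum, SummationFilter.unconditional_filter, Metric.tendsto_atTop]
  intro ε hε
  have hy : Tendsto (fun j => (y : ℓ^∞(J, 𝕜)) j) cofinite (𝓝 0) := y.2
  have hfin := (Metric.tendsto_nhds.1 hy (ε / 2) (half_pos hε))
  rw [eventually_cofinite] at hfin
  refine ⟨hfin.toFinset, fun F hF => ?_⟩
  rw [dist_eq_norm]
  refine lt_of_le_of_lt ?_ (half_lt_self hε)
  refine norm_cZero_le (half_pos hε).le fun i => ?_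
  rw [Submodule.coe_sub, lp.coeFn_sub, Pi.sub_apply, sum_smul_cSingle_apply]
  split_ifs with hi
  · rw [sub_self, norm_zero]
    exact (half_pos hε).le
  · have : i ∉ hfin.toFinset := fun h => hi (hF h)
    rw [Finite.mem_toFinset, mem_ofPred_eq, not_not, dist_zero_right] at this
    rw [zero_sub, norm_neg]
    exact this.le

end Duality

namespace Network

variable {V J : Type*} (N : Network V J) {𝕜 : Type*} [RCLike 𝕜]

theorem summable_column (y : cZero J 𝕜) (j : J) :
    Summable fun i => ‖((N.adjMatrix i j : ℝ) : 𝕜) * (y : ℓ^∞(J, 𝕜)) i‖ := by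
  refine ((N.column_sum j).summable.mul_right ‖y‖).of_nonneg_of_le (fun _ => norm_nonneg _)
    fun i => ?_
  rw [norm_mul, RCLike.norm_ofReal, abs_of_nonneg (N.adjMatrix_nonneg i j)]
  exact mul_le_mul_of_nonneg_left (norm_cZero_apply_le y i) (N.adjMatrix_nonneg i j)

theorem norm_column_le {y : cZero J 𝕜} {j : J} {C : ℝ}
    (h : ∀ i, N.adjMatrix i j ≠ 0 → ‖(y : ℓ^∞(J, 𝕜)) i‖ ≤ C) :
    ‖∑' i, ((N.adjMatrix i j : ℝ) : 𝕜) * (y : ℓ^∞(J, 𝕜)) i‖ ≤ C := by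
  have hs : HasSum (fun i => N.adjMatrix i j * C) (1 * C) := (N.column_sum j).mul_right C
  rw [← one_mul C, ← hs.tsum_eq]
  refine (norm_tsum_le_tsum_norm (N.summable_column y j)).trans
    ((N.summable_column y j).tsum_le_tsum (fun i => ?_) hs.summable)
  rw [norm_mul, RCLike.norm_ofReal, abs_of_nonneg (N.adjMatrix_nonneg i j)]
  rcases eq_or_ne (N.adjMatrix i j) 0 with h0 | h0
  · rw [h0, zero_mul, zero_mul]
  · exact mul_le_mul_of_nonneg_left (h i h0) (N.adjMatrix_nonneg i j)

/-- Every edge has finitely many predecessors, by local finiteness of the graph. -/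
theorem finite_predecessors (i : J) : {j | N.adjMatrix i j ≠ 0}.Finite := by
  refine (N.locallyFinite (N.tail i)).subset fun j hj => Or.inr ?_
  by_contra h
  exact hj (by simp [adjMatrix, DirectedGraph.lineMatrix, h])

theorem tendsto_column (y : cZero J 𝕜) :
    Tendsto (fun j => ∑' i, ((N.adjMatrix i j : ℝ) : 𝕜) * (y : ℓ^∞(J, 𝕜)) i) cofinite (𝓝 0) := by
  have hy : Tendsto (fun j => (y : ℓ^∞(J, 𝕜)) j) cofinite (𝓝 0) := y.2
  rw [Metric.tendsto_nhds] at hy ⊢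
  intro ε hε
  have hfin := hy (ε / 2) (half_pos hε)
  rw [eventually_cofinite] at hfin ⊢
  refine (hfin.biUnion fun i _ => N.finite_predecessors i).subset fun j hj => ?_
  by_contra hc
  refine hj ?_
  rw [dist_zero_right]
  refine (N.norm_column_le fun i hi => ?_).trans_lt (half_lt_self hε)
  by_contra hlt
  refine hc (mem_biUnion (x := i) ?_ hi)
  rw [mem_ofPred_eq, dist_zero_right]
  exact fun h => hlt h.le

variable (𝕜) in
/-- The operator `y ↦ (∑_i 𝔹_ij y_i)_j` on `c₀` given by the transposed matrix; its adjoint is the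
operator `𝔹` on `ℓ¹`. -/
def preadjOp : cZero J 𝕜 →L[𝕜] cZero J 𝕜 :=
  LinearMap.mkContinuous
    { toFun := fun y =>
        ⟨⟨fun j => ∑' i, ((N.adjMatrix i j : ℝ) : 𝕜) * (y : ℓ^∞(J, 𝕜)) i,
          memℓp_infty ⟨‖y‖, by
            rintro _ ⟨j, rfl⟩
            exact N.norm_column_le fun i _ => norm_cZero_apply_le y i⟩⟩, N.tendsto_column y⟩
      map_add' := fun x y => by
        ext j
        simp only [Submodule.coe_add, lp.coeFn_add, Pi.add_apply, mul_add]
        exact (N.summable_column x j).of_norm.tsum_add (N.summable_column y j).of_norm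
      map_smul' := fun c y => by
        ext j
        simp only [Submodule.coe_smul, lp.coeFn_smul, Pi.smul_apply, smul_eq_mul,
          RingHom.id_apply]
        rw [← tsum_mul_left]
        exact tsum_congr fun i => mul_left_comm _ _ _ } 1 fun y => by
    rw [one_mul]
    exact norm_cZero_le (norm_nonneg y) fun j =>
      N.norm_column_le fun i _ => norm_cZero_apply_le y i

theorem norm_preadjOp_le : ‖N.preadjOp 𝕜‖ ≤ 1 := LinearMap.mkContinuous_norm_le _ zero_le_one _

theorem norm_adjOp_le : ‖N.adjOp 𝕜‖ ≤ 1 := LinearMap.mkContinuous_norm_le _ zero_le_one _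

theorem sumPairing_adjOp (x : ℓ¹(J, 𝕜)) (y : cZero J 𝕜) :
    sumPairing 𝕜 J (N.adjOp 𝕜 x) y = sumPairing 𝕜 J x (N.preadjOp 𝕜 y) := by
  have hs : Summable fun p : J × J =>
      ((N.adjMatrix p.2 p.1 : ℝ) : 𝕜) * x p.1 * (y : ℓ^∞(J, 𝕜)) p.2 := by
    refine Summable.of_norm_bounded ((N.summable_adjMatrix_mul_prod x).mul_right ‖y‖) fun p => ?_
    rw [norm_mul, N.norm_entry_mul]
    exact mul_le_mul_of_nonneg_left (norm_cZero_apply_le y p.2)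
      (mul_nonneg (N.adjMatrix_nonneg _ _) (norm_nonneg _))
  calc sumPairing 𝕜 J (N.adjOp 𝕜 x) y
      = ∑' i, ∑' j, ((N.adjMatrix i j : ℝ) : 𝕜) * x j * (y : ℓ^∞(J, 𝕜)) i := by
        rw [sumPairing_apply]
        exact tsum_congr fun i => (tsum_mul_right (a := (y : ℓ^∞(J, 𝕜)) i)).symm
    _ = ∑' j, ∑' i, ((N.adjMatrix i j : ℝ) : 𝕜) * x j * (y : ℓ^∞(J, 𝕜)) i :=
        Summable.tsum_comm
          (f := fun j i => ((N.adjMatrix i j : ℝ) : 𝕜) * x j * (y : ℓ^∞(J, 𝕜)) i) hs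
    _ = _ := by
        rw [sumPairing_apply]
        refine tsum_congr fun j => ?_
        have : ((N.preadjOp 𝕜 y : cZero J 𝕜) : ℓ^∞(J, 𝕜)) j
          = ∑' i, ((N.adjMatrix i j : ℝ) : 𝕜) * (y : ℓ^∞(J, 𝕜)) i := rfl
        rw [this, ← tsum_mul_left]
        exact tsum_congr fun i => by ring

end Network

/-! ### Bi-continuity for the topology of a pairing -/

section PairingTopology

variable {𝕜 E F : Type*} [RCLike 𝕜] [NormedAddCommGroup E] [NormedSpace 𝕜 E]
  [NormedAddCommGroup F] [NormedSpace 𝕜 F]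

/-- The pairing `⟨f, g⟩ = ∫₀¹ b(f(s), g(s)) ds` of `L^∞([0,1], E)` and `L¹([0,1], F)`. -/
abbrev intervalPairing (b : E →L[𝕜] F →L[𝕜] 𝕜) :
    Lp E ∞ unitMeasure →L[𝕜] Lp F 1 unitMeasure →L[𝕜] 𝕜 :=
  b.lpPairing unitMeasure ∞ 1

/-- The coarsest topology on `L^∞([0,1], E)` for which the functionals `⟨·, g⟩`,
`g ∈ L¹([0,1], F)`, are continuous. -/
@[reducible]
def pairingTopology (b : E →L[𝕜] F →L[𝕜] 𝕜) : TopologicalSpace (Lp E ∞ unitMeasure) :=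
  ⨅ g : Lp F 1 unitMeasure,
    TopologicalSpace.induced (fun f => intervalPairing b f g) inferInstance

theorem tendsto_pairingTopology_iff (b : E →L[𝕜] F →L[𝕜] 𝕜) {ι : Type*} {l : Filter ι}
    {u : ι → Lp E ∞ unitMeasure} {x : Lp E ∞ unitMeasure} :
    Tendsto u l (@nhds _ (pairingTopology b) x) ↔
      ∀ g : Lp F 1 unitMeasure,
        Tendsto (fun i => intervalPairing b (u i) g) l (𝓝 (intervalPairing b x g)) := by
  rw [nhds_iInf, tendsto_iInf]
  refine forall_congr' fun g => ?_
  rw [nhds_induced, tendsto_comap_iff]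
  rfl

theorem continuous_pairingTopology_iff (b : E →L[𝕜] F →L[𝕜] 𝕜) {Y : Type*} [TopologicalSpace Y]
    {u : Y → Lp E ∞ unitMeasure} :
    @Continuous _ _ _ (pairingTopology b) u ↔
      ∀ g : Lp F 1 unitMeasure, Continuous fun i => intervalPairing b (u i) g := by
  rw [continuous_iInf_rng]
  exact forall_congr' fun g => continuous_induced_rng

theorem continuous_intervalPairing (b : E →L[𝕜] F →L[𝕜] 𝕜) (g : Lp F 1 unitMeasure) :
    @Continuous _ _ (pairingTopology b) _ fun f => intervalPairing b f g :=
  continuous_iInf_dom (i := g) continuous_induced_dom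

theorem isTopologicalAddGroup_pairingTopology (b : E →L[𝕜] F →L[𝕜] 𝕜) :
    @IsTopologicalAddGroup _ (pairingTopology b) _ :=
  topologicalAddGroup_iInf fun g => topologicalAddGroup_induced ((intervalPairing b).flip g)

theorem continuousSMul_pairingTopology (b : E →L[𝕜] F →L[𝕜] 𝕜) :
    @ContinuousSMul 𝕜 _ _ _ (pairingTopology b) :=
  continuousSMul_iInf fun g => continuousSMul_induced ((intervalPairing b).flip g)

theorem polynormableSpace_pairingTopology (b : E →L[𝕜] F →L[𝕜] 𝕜) :
    @PolynormableSpace 𝕜 _ _ _ _ (pairingTopology b) := by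
  -- the linear map into the product of copies of `𝕜` given by all functionals `⟨·, g⟩`
  have hτ : pairingTopology b = TopologicalSpace.induced
      (LinearMap.pi fun g : Lp F 1 unitMeasure => (((intervalPairing b).flip g) :
        Lp E ∞ unitMeasure →ₗ[𝕜] 𝕜)) inferInstance := by
    rw [pairingTopology, Pi.topologicalSpace, induced_iInf]
    refine iInf_congr fun g => ?_
    rw [induced_compose]
    rfl
  rw [hτ]
  exact PolynormableSpace.induced _

theorem intervalPairing_transportSemigroup {b : E →L[𝕜] F →L[𝕜] 𝕜} {B : E →L[𝕜] E}
    {B' : F →L[𝕜] F} (h : ∀ x y, b (B x) y = b x (B' y)) (hB : ‖B‖ ≤ 1) (hB' : ‖B'‖ ≤ 1) (t : ℝ≥0)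
    (f : Lp E ∞ unitMeasure) (g : Lp F 1 unitMeasure) :
    intervalPairing b (transportSemigroup B hB t f) g
      = intervalPairing b f (preadjointSemigroup B' hB' t g) := by
  rw [ContinuousLinearMap.lpPairing_eq_integral, ContinuousLinearMap.lpPairing_eq_integral]
  have e₁ : ∫ s in Icc (0 : ℝ) 1, b (transportSemigroup B hB t f s) (g s)
      = ∫ s in Icc (0 : ℝ) 1, b (iterExt B f (t + s)) (g s) := by
    apply integral_congr_ae
    filter_upwards [coeFn_transportSemigroup hB t f] with s hs
    rw [hs]
  have e₂ : ∫ s in Icc (0 : ℝ) 1, b (f s) (preadjointSemigroup B' hB' t g s)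
      = ∫ s in Icc (0 : ℝ) 1, b (f s) (iterExt B' (fun y => g (1 - y)) (t + 1 - s)) := by
    apply integral_congr_ae
    filter_upwards [coeFn_preadjointSemigroup hB' t g] with s hs
    rw [hs]
  rw [e₁, e₂, setIntegral_pairing_iterExt h]

variable {b : E →L[𝕜] F →L[𝕜] 𝕜} {B : E →L[𝕜] E} {B' : F →L[𝕜] F}

/-- The modulus of continuity of `t ↦ ⟨T(t) f, g⟩` depends only on `‖f‖` and on `g`. -/
theorem norm_intervalPairing_transportSemigroup_sub_le (h : ∀ x y, b (B x) y = b x (B' y))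
    (hB : ‖B‖ ≤ 1) (hB' : ‖B'‖ ≤ 1) (t r : ℝ≥0) (f : Lp E ∞ unitMeasure)
    (g : Lp F 1 unitMeasure) :
    ‖intervalPairing b (transportSemigroup B hB (r + t) f) g
        - intervalPairing b (transportSemigroup B hB t f) g‖
      ≤ ‖intervalPairing b‖ * ‖f‖ * ‖preadjointSemigroup B' hB' r g - g‖ := by
  rw [transportSemigroup_add, intervalPairing_transportSemigroup h hB hB', ← map_sub]
  refine ((intervalPairing b).le_opNorm₂ _ _).trans ?_
  gcongr
  exact norm_transportSemigroup_apply_le hB t f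

theorem exists_forall_lt_norm_intervalPairing_sub_le (h : ∀ x y, b (B x) y = b x (B' y))
    (hB : ‖B‖ ≤ 1) (hB' : ‖B'‖ ≤ 1) (C : ℝ) (g : Lp F 1 unitMeasure) {ε : ℝ} (hε : 0 < ε) :
    ∃ δ : ℝ≥0, 0 < δ ∧ ∀ r < δ, ∀ t : ℝ≥0, ∀ f : Lp E ∞ unitMeasure, ‖f‖ ≤ C →
      ‖intervalPairing b (transportSemigroup B hB (r + t) f) g
        - intervalPairing b (transportSemigroup B hB t f) g‖ < ε := by
  have hlim : Tendsto (fun r : ℝ≥0 => ‖intervalPairing b‖ * C *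
      ‖preadjointSemigroup B' hB' r g - g‖) (𝓝 0) (𝓝 0) := by
    simpa using (tendsto_norm_preadjointSemigroup_sub hB' g).const_mul (‖intervalPairing b‖ * C)
  obtain ⟨δ, hδ, hδ'⟩ := Metric.eventually_nhds_iff.1 (hlim.eventually_lt_const hε)
  refine ⟨⟨δ, hδ.le⟩, hδ, fun r hr t f hf => ?_⟩
  refine (norm_intervalPairing_transportSemigroup_sub_le h hB hB' t r f g).trans_lt
    (lt_of_le_of_lt ?_ (hδ' (y := r) ?_))
  · gcongr
  · rw [NNReal.dist_eq, NNReal.coe_zero, sub_zero, abs_of_nonneg r.coe_nonneg]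
    exact hr

theorem continuous_intervalPairing_transportSemigroup (h : ∀ x y, b (B x) y = b x (B' y))
    (hB : ‖B‖ ≤ 1) (hB' : ‖B'‖ ≤ 1) (f : Lp E ∞ unitMeasure) (g : Lp F 1 unitMeasure) :
    Continuous fun t => intervalPairing b (transportSemigroup B hB t f) g := by
  rw [Metric.continuous_iff]
  intro t ε hε
  obtain ⟨δ, hδ, hδ'⟩ := exists_forall_lt_norm_intervalPairing_sub_le h hB hB' ‖f‖ g hε
  refine ⟨δ, hδ, fun s hs => ?_⟩
  rw [NNReal.dist_eq] at hs
  rcases le_total t s with hts | hts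
  · have hr : s - t < δ := by
      rw [← NNReal.coe_lt_coe, NNReal.coe_sub hts]
      exact (le_abs_self _).trans_lt hs
    have := hδ' (s - t) hr t f le_rfl
    rwa [tsub_add_cancel_of_le hts, ← dist_eq_norm] at this
  · have hr : t - s < δ := by
      rw [← NNReal.coe_lt_coe, NNReal.coe_sub hts]
      rw [abs_sub_comm] at hs
      exact (le_abs_self _).trans_lt hs
    have := hδ' (t - s) hr s f le_rfl
    rwa [tsub_add_cancel_of_le hts, ← dist_eq_norm, dist_comm] at this

/-- Local bi-equicontinuity: on a grid of mesh `δ` convergence is that of `⟨fₙ, S(kδ) g⟩` for the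
preadjoint semigroup `S`, and between the grid points the functions `t ↦ ⟨T(t) fₙ, g⟩` are
equicontinuous. -/
theorem eventually_forall_le_norm_intervalPairing_lt (h : ∀ x y, b (B x) y = b x (B' y))
    (hB : ‖B‖ ≤ 1) (hB' : ‖B'‖ ≤ 1) {f : ℕ → Lp E ∞ unitMeasure} {C : ℝ} (hC : ∀ n, ‖f n‖ ≤ C)
    (hf : ∀ g : Lp F 1 unitMeasure, Tendsto (fun n => intervalPairing b (f n) g) atTop (𝓝 0))
    (t₀ : ℝ≥0) (g : Lp F 1 unitMeasure) {ε : ℝ} (hε : 0 < ε) :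
    ∀ᶠ n in atTop, ∀ s ≤ t₀, ‖intervalPairing b (transportSemigroup B hB s (f n)) g‖ < ε := by
  obtain ⟨δ, hδ, hδ'⟩ := exists_forall_lt_norm_intervalPairing_sub_le h hB hB' C g (half_pos hε)
  have hgrid : ∀ᶠ n in atTop, ∀ k ∈ Finset.range (⌊t₀ / δ⌋₊ + 1),
      ‖intervalPairing b (transportSemigroup B hB (k * δ) (f n)) g‖ < ε / 2 := by
    rw [Finset.eventually_all]
    intro k _
    have := (hf (preadjointSemigroup B' hB' (k * δ) g)).norm
    rw [norm_zero] at this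
    simp_rw [intervalPairing_transportSemigroup h hB hB']
    exact this.eventually_lt_const (half_pos hε)
  filter_upwards [hgrid] with n hn s hs
  set k := ⌊s / δ⌋₊ with hk
  have hkmem : k ∈ Finset.range (⌊t₀ / δ⌋₊ + 1) := by
    rw [Finset.mem_range, Nat.lt_succ_iff]
    exact Nat.floor_le_floor (by gcongr)
  have hks : (k : ℝ≥0) * δ ≤ s := by
    rw [← le_div_iff₀ hδ]
    exact Nat.floor_le zero_le
  have hlt : s - k * δ < δ := by
    rw [tsub_lt_iff_left hks]
    have := Nat.lt_floor_add_one (s / δ)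
    rw [div_lt_iff₀ hδ, ← hk] at this
    calc s < (k + 1) * δ := this
      _ = k * δ + δ := by ring
  have h₁ := hδ' _ hlt (k * δ) (f n) (hC n)
  rw [tsub_add_cancel_of_le hks] at h₁
  have h₂ := norm_le_norm_sub_add (intervalPairing b (transportSemigroup B hB s (f n)) g)
    (intervalPairing b (transportSemigroup B hB (k * δ) (f n)) g)
  linarith [hn k hkmem]

/-- For a pairing with respect to which the contraction `B` has a preadjoint contraction, the
transport semigroup is bi-continuous as soon as the pairing topology is admissible. -/
theorem isBiContSemigroup_transportSemigroup (h : ∀ x y, b (B x) y = b x (B' y))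
    (hB : ‖B‖ ≤ 1) (hB' : ‖B'‖ ≤ 1) (hτ : IsBiContTopology 𝕜 (pairingTopology b)) :
    IsBiContSemigroup (pairingTopology b) (transportSemigroup B hB) where
  topology := hτ
  map_zero := transportSemigroup_zero hB
  map_add := transportSemigroup_add hB
  stronglyContinuous f := (continuous_pairingTopology_iff b).2 fun g =>
    continuous_intervalPairing_transportSemigroup h hB hB' f g
  exponentiallyBounded := ⟨1, 0, le_rfl, fun t => by
    simpa using norm_transportSemigroup_le hB t⟩
  locallyBiEquicontinuous := by
    rintro f ⟨C, hC⟩ hf t₀ U hU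
    have hf' : ∀ g : Lp F 1 unitMeasure,
        Tendsto (fun n => intervalPairing b (f n) g) atTop (𝓝 0) := by
      simpa using (tendsto_pairingTopology_iff b).1 hf
    -- uniform convergence on `[0, t₀]` is convergence along `atTop ×ˢ 𝓟 [0, t₀]`
    have hunif : Tendsto (fun p : ℕ × ℝ≥0 => transportSemigroup B hB p.2 (f p.1))
        (atTop ×ˢ 𝓟 (Iic t₀)) (@nhds _ (pairingTopology b) 0) := by
      refine (tendsto_pairingTopology_iff b).2 fun g => ?_
      rw [map_zero, zero_apply, Metric.tendsto_nhds]
      intro ε hε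
      rw [eventually_prod_principal_iff]
      filter_upwards [eventually_forall_le_norm_intervalPairing_lt h hB hB' hC hf' t₀ g hε]
        with n hn s hs
      rw [dist_zero_right]
      exact hn s hs
    have := hunif.eventually hU
    rw [eventually_prod_principal_iff] at this
    exact this

end PairingTopology

/-! ### Weak derivatives and primitives -/

section WeakDerivative

theorem exists_Icc_of_tsupport_subset {φ : ℝ → ℝ} (hc : HasCompactSupport φ)
    (hs : tsupport φ ⊆ Ioo 0 1) : ∃ δ : ℝ, 0 < δ ∧ δ < 1 / 2 ∧ ∀ x ∉ Icc δ (1 - δ), φ x = 0 := by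
  have hd : Disjoint (tsupport φ) (Ioo (0 : ℝ) 1)ᶜ := disjoint_compl_right_iff_subset.2 hs
  obtain ⟨r, hr, hr'⟩ := hd.exists_thickenings hc isOpen_Ioo.isClosed_compl
  refine ⟨min (r / 2) (1 / 4), by positivity, by
    have := min_le_right (r / 2) (1 / 4)
    linarith, fun x hx => ?_⟩
  by_contra hne
  have hx' : x ∈ tsupport φ := subset_tsupport _ hne
  have hmin := min_le_left (r / 2) (1 / 4)
  have h01 := hs hx'
  have hfar : ∀ y ∉ Ioo (0 : ℝ) 1, r ≤ |x - y| := fun y hy => by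
    by_contra! hlt
    refine Set.disjoint_left.1 hr' (Metric.self_subset_thickening hr _ hx') ?_
    exact Metric.mem_thickening_iff.2 ⟨y, hy, hlt⟩
  have h0 := hfar 0 (by simp)
  have h1 := hfar 1 (by simp)
  rw [abs_of_pos (by linarith [h01.1])] at h0
  rw [abs_of_neg (by linarith [h01.2])] at h1
  exact hx ⟨by linarith, by linarith⟩

theorem integrable_continuous_smul {E : Type*} [NormedAddCommGroup E] [NormedSpace ℝ E] {φ : ℝ → ℝ}
    (hφ : Continuous φ) {k : ℝ → E} (hk : Integrable k unitMeasure) :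
    Integrable (fun s => φ s • k s) unitMeasure := by
  obtain ⟨C, hC⟩ := isCompact_Icc.exists_bound_of_continuousOn (s := Icc (0 : ℝ) 1)
    hφ.continuousOn
  refine hk.bdd_smul C hφ.aestronglyMeasurable ?_
  filter_upwards [ae_unitMeasure_mem] with s hs using hC s hs

/-- Integration by parts for the primitive of a scalar integrable function. -/
theorem integral_deriv_mul_primitive {φ : ℝ → ℝ} (hφ : ContDiff ℝ ∞ φ) (h0 : φ 0 = 0)
    (h1 : φ 1 = 0) {g : ℝ → ℝ} (hg : IntervalIntegrable g volume 0 1) :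
    ∫ s in (0 : ℝ)..1, deriv φ s * ∫ r in (0 : ℝ)..s, g r = -∫ s in (0 : ℝ)..1, φ s * g s := by
  have hac : AbsolutelyContinuousOnInterval φ 0 1 :=
    (hφ.of_le (by simp)).contDiffOn.absolutelyContinuousOnInterval
  have hacg := hg.absolutelyContinuousOnInterval_intervalIntegral (c := 0) left_mem_uIcc
  have h := hac.integral_mul_deriv_eq_deriv_mul hacg
  rw [h0, h1, zero_mul, zero_mul, sub_zero, zero_sub] at h
  have hae : ∫ s in (0 : ℝ)..1, φ s * deriv (fun x => ∫ r in (0 : ℝ)..x, g r) s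
      = ∫ s in (0 : ℝ)..1, φ s * g s := by
    apply intervalIntegral.integral_congr_ae
    filter_upwards [hg.ae_hasDerivAt_integral] with s hs hs'
    rw [(hs (uIoc_subset_uIcc hs') 0 left_mem_uIcc).deriv]
  rw [← hae, h, neg_neg]

theorem continuousOn_primitive_unitMeasure {E : Type*} [NormedAddCommGroup E] [NormedSpace ℝ E]
    {g : ℝ → E} (hg : Integrable g unitMeasure) :
    ContinuousOn (fun s => ∫ r in (0 : ℝ)..s, g r) (Icc 0 1) := by
  have := intervalIntegral.continuousOn_primitive_interval (a := 0) (b := 1) (f := g)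
    (by rwa [uIcc_of_le zero_le_one])
  rwa [uIcc_of_le zero_le_one] at this

variable {E : Type*} [NormedAddCommGroup E] [NormedSpace ℝ E] [CompleteSpace E]

/-- Integration by parts for the primitive of an integrable function with values in a Banach space,
reduced to the scalar case by functionals. -/
theorem setIntegral_deriv_smul_primitive {φ : ℝ → ℝ} (hφ : ContDiff ℝ ∞ φ)
    (hs : tsupport φ ⊆ Ioo 0 1) {g : ℝ → E} (hg : Integrable g unitMeasure) :
    ∫ s in Icc (0 : ℝ) 1, deriv φ s • ∫ r in (0 : ℝ)..s, g r
      = -∫ s in Icc (0 : ℝ) 1, φ s • g s := by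
  have h0 : φ 0 = 0 := image_eq_zero_of_notMem_tsupport fun h => by simpa using hs h
  have h1 : φ 1 = 0 := image_eq_zero_of_notMem_tsupport fun h => by simpa using hs h
  have hW := continuousOn_primitive_unitMeasure hg
  have hd : Continuous (deriv φ) := hφ.continuous_deriv (by simp)
  have i₁ : Integrable (fun s => deriv φ s • ∫ r in (0 : ℝ)..s, g r) unitMeasure :=
    (hd.continuousOn.smul hW).integrableOn_Icc
  have i₂ : Integrable (fun s => φ s • g s) unitMeasure :=
    integrable_continuous_smul hφ.continuous hg
  refine (SeparatingDual.eq_iff_forall_dual_eq (R := ℝ)).2 fun ℓ => ?_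
  rw [map_neg, ← ℓ.integral_comp_comm i₁, ← ℓ.integral_comp_comm i₂]
  have hℓg : Integrable (fun s => ℓ (g s)) unitMeasure := ℓ.integrable_comp hg
  have key := integral_deriv_mul_primitive hφ h0 h1 (g := fun s => ℓ (g s))
    ((intervalIntegrable_iff_integrableOn_Icc_of_le zero_le_one).2 hℓg)
  rw [intervalIntegral.integral_of_le zero_le_one, intervalIntegral.integral_of_le zero_le_one,
    ← integral_Icc_eq_integral_Ioc, ← integral_Icc_eq_integral_Ioc] at key
  refine Eq.trans ?_ (key.trans ?_)
  · refine setIntegral_congr_fun measurableSet_Icc fun s hs => ?_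
    simp only [map_smul, smul_eq_mul]
    rw [ℓ.intervalIntegral_comp_comm]
    rw [intervalIntegrable_iff_integrableOn_Icc_of_le hs.1]
    exact IntegrableOn.mono_set hg (Icc_subset_Icc_right hs.2)
  · congr 1
    refine setIntegral_congr_fun measurableSet_Icc fun s _ => ?_
    simp only [map_smul, smul_eq_mul]

/-- A smooth function with compact support in `(0,1)` and integral zero is the derivative of a
function of the same kind. -/
theorem exists_deriv_eq_of_integral_eq_zero {η : ℝ → ℝ} (hη : ContDiff ℝ ∞ η)
    (hc : HasCompactSupport η) (hs : tsupport η ⊆ Ioo 0 1) (h0 : ∫ x in (0 : ℝ)..1, η x = 0) :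
    ∃ φ : ℝ → ℝ, ContDiff ℝ ∞ φ ∧ HasCompactSupport φ ∧ tsupport φ ⊆ Ioo 0 1 ∧ deriv φ = η := by
  obtain ⟨δ, hδ, hδ', hz⟩ := exists_Icc_of_tsupport_subset hc hs
  have hder : ∀ x, HasDerivAt (fun y => ∫ r in (0 : ℝ)..y, η r) (η x) x := fun x =>
    hη.continuous.integral_hasStrictDerivAt 0 x |>.hasDerivAt
  have hderiv : deriv (fun y => ∫ r in (0 : ℝ)..y, η r) = η := funext fun x => (hder x).deriv
  have hii : ∀ a b, IntervalIntegrable η volume a b := fun a b =>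
    hη.continuous.intervalIntegrable a b
  have hsupp : Function.support (fun y => ∫ r in (0 : ℝ)..y, η r) ⊆ Icc δ (1 - δ) := by
    intro x hx
    by_contra hxI
    refine hx ?_
    rw [mem_Icc, not_and_or, not_le, not_le] at hxI
    simp only
    rcases hxI with hlt | hgt
    · refine (intervalIntegral.integral_congr (g := fun _ => (0 : ℝ)) fun y hy => ?_).trans
        intervalIntegral.integral_zero
      refine hz y fun hyI => ?_
      have : y ≤ max 0 x := hy.2
      have : max 0 x < δ := max_lt hδ hlt
      linarith [hyI.1]
    · rw [← intervalIntegral.integral_add_adjacent_intervals (hii 0 1) (hii 1 x), h0, zero_add]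
      refine (intervalIntegral.integral_congr (g := fun _ => (0 : ℝ)) fun y hy => ?_).trans
        intervalIntegral.integral_zero
      refine hz y fun hyI => ?_
      have : min 1 x ≤ y := hy.1
      have : 1 - δ < min 1 x := lt_min (by linarith) hgt
      linarith [hyI.2]
  have hts : tsupport (fun y => ∫ r in (0 : ℝ)..y, η r) ⊆ Icc δ (1 - δ) :=
    closure_minimal hsupp isClosed_Icc
  refine ⟨fun y => ∫ r in (0 : ℝ)..y, η r, ?_, ?_, ?_, hderiv⟩
  · rw [contDiff_infty_iff_deriv, hderiv]
    exact ⟨fun x => (hder x).differentiableAt, hη⟩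
  · exact HasCompactSupport.of_support_subset_isCompact isCompact_Icc hsupp
  · exact hts.trans (Icc_subset_Ioo hδ (by linarith))

/-- The lemma of du Bois-Reymond: an element of `W^{1,∞}([0,1], E)` is, up to a constant, the
primitive of its weak derivative. -/
theorem HasWeakDeriv.exists_ae_eq_primitive {v g : Lp E ∞ unitMeasure} (h : HasWeakDeriv v g) :
    ∃ c : E, ∀ᵐ s ∂unitMeasure, v s = c + ∫ r in (0 : ℝ)..s, g r := by
  have hgi : Integrable g unitMeasure := (Lp.memLp g).integrable le_top
  have hvi : Integrable v unitMeasure := (Lp.memLp v).integrable le_top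
  have hWi : Integrable (fun s => ∫ r in (0 : ℝ)..s, g r) unitMeasure :=
    (continuousOn_primitive_unitMeasure hgi).integrableOn_Icc
  set w : ℝ → E := fun s => v s - ∫ r in (0 : ℝ)..s, g r with hw
  have hwi : Integrable w unitMeasure := hvi.sub hWi
  have hzero : ∀ φ : ℝ → ℝ, ContDiff ℝ ∞ φ → HasCompactSupport φ → tsupport φ ⊆ Ioo 0 1 →
      ∫ s in Icc (0 : ℝ) 1, deriv φ s • w s = 0 := by
    intro φ hφ hc hs
    have hd : Continuous (deriv φ) := hφ.continuous_deriv (by simp)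
    simp_rw [hw, smul_sub]
    rw [integral_sub (integrable_continuous_smul hd hvi) (integrable_continuous_smul hd hWi),
      h φ hφ hc hs, setIntegral_deriv_smul_primitive hφ hs hgi, sub_self]
  -- a test function `ψ₀` with integral one
  let β : ContDiffBump (1 / 2 : ℝ) := ⟨1 / 8, 1 / 4, by norm_num, by norm_num⟩
  set ψ₀ : ℝ → ℝ := β.normed volume with hψ₀
  have hψs : tsupport ψ₀ ⊆ Ioo 0 1 := by
    rw [hψ₀, β.tsupport_normed_eq, Real.closedBall_eq_Icc]
    exact Icc_subset_Ioo (by norm_num [β]) (by norm_num [β])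
  have hψsm : ContDiff ℝ ∞ ψ₀ := β.contDiff_normed
  have hψc : HasCompactSupport ψ₀ := β.hasCompactSupport_normed
  have hint01 : ∀ φ : ℝ → ℝ, tsupport φ ⊆ Ioo 0 1 → ∫ x in (0 : ℝ)..1, φ x = ∫ x, φ x := by
    intro φ hφ
    exact intervalIntegral.integral_eq_integral_of_support_subset
      ((subset_tsupport φ).trans (hφ.trans Ioo_subset_Ioc_self))
  have hψ1 : ∫ x in (0 : ℝ)..1, ψ₀ x = 1 := by
    rw [hint01 ψ₀ hψs]
    exact β.integral_normed
  set c : E := ∫ s in Icc (0 : ℝ) 1, ψ₀ s • w s with hcdef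
  refine ⟨c, ?_⟩
  have key : ∀ᵐ s ∂(volume : Measure ℝ), s ∈ Ioo (0 : ℝ) 1 → w s - c = 0 := by
    have hwc : Integrable (fun s => w s - c) unitMeasure := hwi.sub (integrable_const c)
    apply isOpen_Ioo.ae_eq_zero_of_integral_contDiff_smul_eq_zero
    · have : IntegrableOn (fun s => w s - c) (Icc (0 : ℝ) 1) := hwc
      exact (this.mono_set Ioo_subset_Icc_self).locallyIntegrableOn
    · intro ψ hψ hψc' hψs'
      have hz : ∫ s, ψ s • (w s - c) = ∫ s in Icc (0 : ℝ) 1, ψ s • (w s - c) := by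
        symm
        apply setIntegral_eq_integral_of_forall_compl_eq_zero
        intro s hs'
        rw [image_eq_zero_of_notMem_tsupport fun h => hs' (Ioo_subset_Icc_self (hψs' h)), zero_smul]
      set a : ℝ := ∫ x in (0 : ℝ)..1, ψ x with ha
      have hη : ContDiff ℝ ∞ (fun x => ψ x - a * ψ₀ x) := hψ.sub (contDiff_const.mul hψsm)
      have hηs : tsupport (fun x => ψ x - a * ψ₀ x) ⊆ Ioo 0 1 :=
        (tsupport_sub ψ fun x => a * ψ₀ x).trans
          (union_subset hψs' ((tsupport_mul_subset_right (f := fun _ => a) (g := ψ₀)).trans hψs))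
      have hηc : HasCompactSupport (fun x => ψ x - a * ψ₀ x) :=
        hψc'.sub (hψc.mul_left (f := fun _ => a))
      obtain ⟨φ, h₁, h₂, h₃, h₄⟩ := exists_deriv_eq_of_integral_eq_zero hη hηc hηs (by
        rw [intervalIntegral.integral_sub (hψ.continuous.intervalIntegrable _ _)
          ((hψsm.continuous.const_mul a).intervalIntegrable _ _),
          intervalIntegral.integral_const_mul, hψ1, mul_one, sub_self])
      have h₅ := hzero φ h₁ h₂ h₃
      rw [h₄] at h₅
      simp_rw [sub_smul, mul_smul] at h₅
      have hi : Integrable (fun s => a • ψ₀ s • w s) unitMeasure :=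
        (integrable_continuous_smul hψsm.continuous hwi).smul a
      rw [integral_sub (integrable_continuous_smul hψ.continuous hwi) hi, integral_smul, ← hcdef,
        sub_eq_zero] at h₅
      have h₆ : ∫ s in Icc (0 : ℝ) 1, ψ s • c = a • c := by
        rw [integral_smul_const, ha, intervalIntegral.integral_of_le zero_le_one,
          integral_Icc_eq_integral_Ioc]
      rw [hz]
      simp_rw [smul_sub]
      rw [integral_sub (integrable_continuous_smul hψ.continuous hwi)
        (integrable_continuous_smul hψ.continuous (integrable_const c)), h₅, h₆, sub_self]
  have := (ae_restrict_iff' measurableSet_Ioo).2 key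
  rw [show volume.restrict (Ioo (0 : ℝ) 1) = unitMeasure from
    Measure.restrict_congr_set Ioo_ae_eq_Icc] at this
  filter_upwards [this] with s hs
  rw [sub_eq_zero, hw] at hs
  rw [← hs, sub_add_cancel]

end WeakDerivative

/-! ### The generator -/

section Generator

variable {𝕜 E : Type*} [RCLike 𝕜] [NormedAddCommGroup E] [NormedSpace ℝ E] [NormedSpace 𝕜 E]
  [CompleteSpace E]

theorem integral_iterExt_of_mem {B : E →L[𝕜] E} {g : ℝ → E}
    (hg : Integrable g unitMeasure) {n : ℕ} {x : ℝ} (hx : x ∈ Icc (n : ℝ) (n + 1)) :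
    ∫ y in (n : ℝ)..x, iterExt B g y = (B ^ n) (∫ y in (0 : ℝ)..(x - n), g y) := by
  have h₁ : ∫ y in (n : ℝ)..x, iterExt B g y = ∫ y in (n : ℝ)..x, (B ^ n) (g (y - n)) := by
    apply intervalIntegral.integral_congr_ae
    filter_upwards [(countable_singleton ((n : ℝ) + 1)).ae_notMem volume] with y hy hy'
    rw [uIoc_of_le hx.1] at hy'
    exact iterExt_eq B g hy'.1.le (lt_of_le_of_ne (hy'.2.trans hx.2) (by simpa using hy))
  rw [h₁, intervalIntegral.integral_comp_sub_right (fun y => (B ^ n) (g y)), sub_self,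
    ContinuousLinearMap.intervalIntegral_comp_comm]
  rw [intervalIntegrable_iff_integrableOn_Icc_of_le (by linarith [hx.1])]
  exact IntegrableOn.mono_set hg (Icc_subset_Icc_right (by linarith [hx.2]))

/-- If `u` is a primitive of `g` on `[0,1]` and `u(1) = B u(0)`, then the extension of `u` is a
primitive of the extension of `g`. -/
theorem iterExt_eq_add_integral {B : E →L[𝕜] E} (hB : ‖B‖ ≤ 1) {u g : ℝ → E}
    (hg : Integrable g unitMeasure)
    (hu : ∀ s ∈ Icc (0 : ℝ) 1, u s = u 0 + ∫ r in (0 : ℝ)..s, g r) (hb : u 1 = B (u 0))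
    {x : ℝ} (hx : 0 ≤ x) : iterExt B u x = u 0 + ∫ y in (0 : ℝ)..x, iterExt B g y := by
  have hii := intervalIntegrable_iterExt hB hg
  have hnat : ∀ n : ℕ, ∫ y in (0 : ℝ)..n, iterExt B g y = (B ^ n) (u 0) - u 0 := by
    intro n
    induction n with
    | zero => simp
    | succ n ih =>
      have h1 : ∫ y in (0 : ℝ)..1, g y = B (u 0) - u 0 := by
        rw [← hb, hu 1 (right_mem_Icc.2 zero_le_one), add_sub_cancel_left]
      rw [← intervalIntegral.integral_add_adjacent_intervals (hii 0 n) (hii n _), ih,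
        integral_iterExt_of_mem hg ⟨by simp, by simp⟩, Nat.cast_succ, add_sub_cancel_left, h1,
        map_sub, pow_succ, mul_apply_eq_comp]
      abel
  set n := ⌊x⌋₊ with hn
  have h₁ : (n : ℝ) ≤ x := Nat.floor_le hx
  have h₂ : x < n + 1 := Nat.lt_floor_add_one x
  rw [iterExt_eq B u h₁ h₂, ← intervalIntegral.integral_add_adjacent_intervals (hii 0 n) (hii n x),
    hnat, integral_iterExt_of_mem hg ⟨h₁, h₂.le⟩, hu (x - n) ⟨by linarith, by linarith⟩, map_add]
  abel

/-- For `(v, g)` in the graph of `A` the orbit satisfies `T(t) v - v = ∫₀ᵗ T(r) g dr`. -/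
theorem transportSemigroup_sub_ae_eq {B : E →L[𝕜] E} (hB : ‖B‖ ≤ 1) {v g : Lp E ∞ unitMeasure}
    (hv : HasWeakDeriv v g) (hb : v ∈ boundarySpace B) (t : ℝ≥0) :
    ∀ᵐ s ∂unitMeasure,
      (transportSemigroup B hB t v - v) s = ∫ y in s..(s + t), iterExt B g y := by
  obtain ⟨u, huc, hvu, hub⟩ := hb
  obtain ⟨c, hc⟩ := hv.exists_ae_eq_primitive
  have hgi : Integrable g unitMeasure := (Lp.memLp g).integrable le_top
  have hEq : EqOn u (fun s => c + ∫ r in (0 : ℝ)..s, g r) (Icc 0 1) := by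
    refine Measure.eqOn_Icc_of_ae_eq volume zero_ne_one ?_ huc
      (continuousOn_const.add (continuousOn_primitive_unitMeasure hgi))
    filter_upwards [hvu, hc] with s h₁ h₂
    rw [← h₁, h₂]
  have hu0 : u 0 = c := by
    simpa using hEq (left_mem_Icc.2 zero_le_one)
  have hu : ∀ s ∈ Icc (0 : ℝ) 1, u s = u 0 + ∫ r in (0 : ℝ)..s, g r := fun s hs => by
    rw [hEq hs, hu0]
  have hii := intervalIntegrable_iterExt hB hgi
  filter_upwards [Lp.coeFn_sub (transportSemigroup B hB t v) v, coeFn_transportSemigroup hB t v,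
    (quasiMeasurePreserving_shift t).ae (iterExt_congr_ae B hvu), hvu,
    ae_unitMeasure_mem_Ioo] with s h₁ h₂ h₃ h₄ hs
  rw [h₁, Pi.sub_apply, h₂, h₃, h₄, ← iterExt_of_mem_Ico B u ⟨hs.1.le, hs.2⟩,
    iterExt_eq_add_integral hB hgi hu hub hs.1.le,
    iterExt_eq_add_integral hB hgi hu hub (add_nonneg t.coe_nonneg hs.1.le),
    add_sub_add_left_eq_sub, intervalIntegral.integral_interval_sub_left (hii _ _) (hii _ _),
    add_comm (t : ℝ)]

theorem norm_transportSemigroup_sub_le {B : E →L[𝕜] E} (hB : ‖B‖ ≤ 1) {v g : Lp E ∞ unitMeasure}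
    (hv : HasWeakDeriv v g) (hb : v ∈ boundarySpace B) (t : ℝ≥0) :
    ‖transportSemigroup B hB t v - v‖ ≤ ‖g‖ * t := by
  refine norm_le_of_ae_norm_le (by positivity) ?_
  filter_upwards [transportSemigroup_sub_ae_eq hB hv hb t] with s hs
  rw [hs]
  have := intervalIntegral.norm_integral_le_of_norm_le_const_ae (a := s) (b := s + t)
    (f := iterExt B g) (C := ‖g‖) (by
      filter_upwards [ae_norm_iterExt_le hB g] with x hx _ using hx)
  rwa [add_sub_cancel_left, abs_of_nonneg t.coe_nonneg] at this

theorem tendsto_coe_nhdsGT_zero :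
    Tendsto (fun t : ℝ≥0 => (t : ℝ)) (𝓝[>] 0) (𝓝[>] 0) := by
  refine tendsto_nhdsWithin_iff.2 ⟨?_, ?_⟩
  · exact (NNReal.continuous_coe.tendsto' 0 0 rfl).mono_left nhdsWithin_le_nhds
  · filter_upwards [self_mem_nhdsWithin] with t ht
    exact NNReal.coe_pos.2 ht

/-- Boundedness of the difference quotients forces the boundary condition: the orbit jumps by
`B u(0) - u(1)` at the right endpoint. -/
theorem mem_boundarySpace_of_norm_le {B : E →L[𝕜] E} (hB : ‖B‖ ≤ 1)
    {f g : Lp E ∞ unitMeasure} (hf : HasWeakDeriv f g) {C : ℝ}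
    (hC : ∀ t : ℝ≥0, 0 < t → t ≤ 1 → ‖transportSemigroup B hB t f - f‖ / t ≤ C) :
    f ∈ boundarySpace B := by
  have hgi : Integrable g unitMeasure := (Lp.memLp g).integrable le_top
  obtain ⟨c, hc⟩ := hf.exists_ae_eq_primitive
  set u : ℝ → E := fun s => c + ∫ r in (0 : ℝ)..s, g r with hu
  have huc : ContinuousOn u (Icc 0 1) :=
    continuousOn_const.add (continuousOn_primitive_unitMeasure hgi)
  refine ⟨u, huc, hc, ?_⟩
  have hex : ∀ n : ℕ, ∃ s ∈ Ioo (1 - 1 / ((n : ℝ) + 1)) 1,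
      ‖B (u (1 / ((n : ℝ) + 1) + s - 1)) - u s‖ ≤ C * (1 / ((n : ℝ) + 1)) := by
    intro n
    have htpos : (0 : ℝ) < 1 / ((n : ℝ) + 1) := by positivity
    have ht1 : 1 / ((n : ℝ) + 1) ≤ 1 := by
      rw [div_le_one (by positivity)]
      linarith [(Nat.cast_nonneg n : (0 : ℝ) ≤ n)]
    set t : ℝ≥0 := ⟨1 / ((n : ℝ) + 1), htpos.le⟩ with ht
    have htc : (t : ℝ) = 1 / ((n : ℝ) + 1) := rfl
    have hbd : ‖transportSemigroup B hB t f - f‖ ≤ C * t :=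
      (div_le_iff₀ (by exact htpos)).1 (hC t htpos ht1)
    have hall : ∀ᵐ s ∂unitMeasure, s ∈ Ioo (1 - (t : ℝ)) 1 →
        ‖B (u (t + s - 1)) - u s‖ ≤ C * t := by
      filter_upwards [ae_norm_coeFn_le_norm (transportSemigroup B hB t f - f),
        Lp.coeFn_sub (transportSemigroup B hB t f) f, coeFn_transportSemigroup hB t f,
        (quasiMeasurePreserving_shift t).ae (iterExt_congr_ae B hc), hc] with s h₁ h₂ h₃ h₄ h₅ hs
      rw [h₂, Pi.sub_apply, h₃, h₄, h₅,
        iterExt_eq B _ (n := 1) (by push_cast; linarith [hs.1])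
          (by push_cast; linarith [hs.2, ht1, htc])] at h₁
      rw [pow_one, Nat.cast_one] at h₁
      exact h₁.trans hbd
    have hmem : ∃ᵐ s ∂unitMeasure, s ∈ Ioo (1 - (t : ℝ)) 1 := by
      rw [frequently_ae_mem_iff, Measure.restrict_apply measurableSet_Ioo,
        inter_eq_left.2 ((Ioo_subset_Ioo_left (by linarith)).trans Ioo_subset_Icc_self),
        Real.volume_Ioo]
      rw [sub_sub_cancel, Ne, ENNReal.ofReal_eq_zero, not_le]
      exact htpos
    obtain ⟨s, hs, hs'⟩ := (hmem.and_eventually hall).exists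
    exact ⟨s, hs, hs' hs⟩
  choose s hs hsb using hex
  have htend : Tendsto (fun n : ℕ => 1 / ((n : ℝ) + 1)) atTop (𝓝 0) :=
    tendsto_one_div_add_atTop_nhds_zero_nat
  have ht1 : ∀ n : ℕ, 1 / ((n : ℝ) + 1) ≤ 1 := fun n => by
    rw [div_le_one (by positivity)]
    linarith [(Nat.cast_nonneg n : (0 : ℝ) ≤ n)]
  have hs1 : Tendsto s atTop (𝓝 1) :=
    tendsto_of_tendsto_of_tendsto_of_le_of_le (by simpa using htend.const_sub 1)
      tendsto_const_nhds (fun n => (hs n).1.le) fun n => (hs n).2.le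
  have l₁ : Tendsto (fun n => u (s n)) atTop (𝓝 (u 1)) := by
    refine (huc 1 (right_mem_Icc.2 zero_le_one)).tendsto.comp (tendsto_nhdsWithin_iff.2
      ⟨hs1, Eventually.of_forall fun n => ⟨?_, (hs n).2.le⟩⟩)
    linarith [(hs n).1, ht1 n]
  have l₂ : Tendsto (fun n : ℕ => u (1 / ((n : ℝ) + 1) + s n - 1)) atTop (𝓝 (u 0)) := by
    refine (huc 0 (left_mem_Icc.2 zero_le_one)).tendsto.comp (tendsto_nhdsWithin_iff.2
      ⟨by simpa using (htend.add hs1).sub_const 1,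
        Eventually.of_forall fun n => ⟨?_, ?_⟩⟩)
    · linarith [(hs n).1]
    · linarith [(hs n).2, ht1 n]
  have l₃ : Tendsto (fun n : ℕ => ‖B (u (1 / ((n : ℝ) + 1) + s n - 1)) - u (s n)‖) atTop
      (𝓝 ‖B (u 0) - u 1‖) := (((B.continuous.tendsto _).comp l₂).sub l₁).norm
  have l₄ : Tendsto (fun n : ℕ => C * (1 / ((n : ℝ) + 1))) atTop (𝓝 0) := by
    simpa using htend.const_mul C
  have hle : ‖B (u 0) - u 1‖ ≤ 0 := le_of_tendsto_of_tendsto' l₃ l₄ hsb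
  exact (sub_eq_zero.1 (norm_le_zero_iff.1 hle)).symm

variable {F : Type*} [NormedAddCommGroup F] [NormedSpace 𝕜 F] [IsScalarTower ℝ 𝕜 E]

/-- The difference quotients of an orbit that starts in `D(A)` converge, by Lebesgue's theorems on
differentiation and on dominated convergence. -/
theorem tendsto_intervalPairing_of_hasWeakDeriv (b : E →L[𝕜] F →L[𝕜] 𝕜) {B : E →L[𝕜] E}
    (hB : ‖B‖ ≤ 1) {v g : Lp E ∞ unitMeasure} (hv : HasWeakDeriv v g) (hb : v ∈ boundarySpace B)
    (k : Lp F 1 unitMeasure) :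
    Tendsto (fun t : ℝ≥0 => intervalPairing b
      ((((t : ℝ)⁻¹ : ℝ) : 𝕜) • (transportSemigroup B hB t v - v)) k) (𝓝[>] 0)
      (𝓝 (intervalPairing b g k)) := by
  have hgi : Integrable g unitMeasure := (Lp.memLp g).integrable le_top
  have hii := intervalIntegrable_iterExt hB hgi
  set D : ℝ≥0 → ℝ → E := fun t s => (t : ℝ)⁻¹ • ∫ y in s..(s + t), iterExt B g y with hD
  have hae : ∀ t : ℝ≥0, ((((t : ℝ)⁻¹ : ℝ) : 𝕜) • (transportSemigroup B hB t v - v) :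
      Lp E ∞ unitMeasure) =ᵐ[unitMeasure] D t := fun t => by
    filter_upwards [Lp.coeFn_smul (((t : ℝ)⁻¹ : ℝ) : 𝕜) (transportSemigroup B hB t v - v),
      transportSemigroup_sub_ae_eq hB hv hb t] with s h₁ h₂
    rw [h₁, Pi.smul_apply, h₂]
    exact (RCLike.real_smul_eq_coe_smul _ _).symm
  have hmeas : ∀ t : ℝ≥0, AEStronglyMeasurable (fun s => b (D t s) (k s)) unitMeasure := fun t =>
    b.aestronglyMeasurable_comp₂ ((Lp.aestronglyMeasurable _).congr (hae t))
      (Lp.aestronglyMeasurable k)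
  have hbound : ∀ t : ℝ≥0, 0 < t → ∀ s, ‖D t s‖ ≤ ‖g‖ := fun t ht s => by
    have := intervalIntegral.norm_integral_le_of_norm_le_const_ae (a := s) (b := s + t)
      (f := iterExt B g) (C := ‖g‖) (by
        filter_upwards [ae_norm_iterExt_le hB g] with x hx _ using hx)
    rw [add_sub_cancel_left, abs_of_nonneg t.coe_nonneg] at this
    rw [hD, norm_smul, norm_inv, Real.norm_of_nonneg t.coe_nonneg,
      inv_mul_le_iff₀ (NNReal.coe_pos.2 ht), mul_comm]
    exact this
  have hpt : ∀ᵐ s ∂unitMeasure, Tendsto (fun t => D t s) (𝓝[>] 0) (𝓝 (g s)) := by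
    filter_upwards [ae_restrict_of_ae (hii 0 2).ae_hasDerivAt_integral, ae_unitMeasure_mem_Ioo]
      with s hs hs01
    have hder := hs (by rw [uIcc_of_le zero_le_two]; exact ⟨hs01.1.le, by linarith [hs01.2]⟩) 0
      left_mem_uIcc
    rw [iterExt_of_mem_Ico B g ⟨hs01.1.le, hs01.2⟩] at hder
    have := (hder.tendsto_slope_zero.mono_left (nhdsGT_le_nhdsNE 0)).comp tendsto_coe_nhdsGT_zero
    refine this.congr fun t => ?_
    rw [Function.comp_apply, intervalIntegral.integral_interval_sub_left (hii _ _) (hii _ _)]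
  have hmain : Tendsto (fun t => ∫ s in Icc (0 : ℝ) 1, b (D t s) (k s)) (𝓝[>] 0)
      (𝓝 (∫ s in Icc (0 : ℝ) 1, b (g s) (k s))) := by
    refine tendsto_integral_filter_of_dominated_convergence (fun s => ‖b‖ * ‖g‖ * ‖k s‖)
      (Eventually.of_forall hmeas) ?_ ((L1.integrable_coeFn k).norm.const_mul _) ?_
    · filter_upwards [self_mem_nhdsWithin] with t ht
      refine Eventually.of_forall fun s => (b.le_opNorm₂ _ _).trans ?_
      gcongr
      exact hbound t ht s
    · filter_upwards [hpt] with s hs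
      exact ((b.flip (k s)).continuous.tendsto _).comp hs
  rw [ContinuousLinearMap.lpPairing_eq_integral]
  refine hmain.congr fun t => ?_
  rw [ContinuousLinearMap.lpPairing_eq_integral]
  apply integral_congr_ae
  filter_upwards [hae t] with s hs
  rw [hs]

/-- The predual element `s ↦ φ(s) y`. -/
def testElement (φ : ℝ → ℝ) (hφ : Continuous φ) (y : F) : Lp F 1 unitMeasure :=
  Integrable.toL1 (fun s => ((φ s : ℝ) : 𝕜) • y)
    (Continuous.integrableOn_Icc (by fun_prop))

theorem coeFn_testElement (φ : ℝ → ℝ) (hφ : Continuous φ) (y : F) :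
    testElement (𝕜 := 𝕜) φ hφ y =ᵐ[unitMeasure] fun s => ((φ s : ℝ) : 𝕜) • y :=
  Integrable.coeFn_toL1 _

theorem intervalPairing_testElement (b : E →L[𝕜] F →L[𝕜] 𝕜) (f : Lp E ∞ unitMeasure) {φ : ℝ → ℝ}
    (hφ : Continuous φ) (y : F) :
    intervalPairing b f (testElement (𝕜 := 𝕜) φ hφ y)
      = b (∫ s in Icc (0 : ℝ) 1, φ s • f s) y := by
  have hi : Integrable (fun s => φ s • f s) unitMeasure :=
    integrable_continuous_smul hφ ((Lp.memLp f).integrable le_top)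
  rw [ContinuousLinearMap.lpPairing_eq_integral, ← ContinuousLinearMap.flip_apply b,
    ← ContinuousLinearMap.integral_comp_comm _ hi]
  apply integral_congr_ae
  filter_upwards [coeFn_testElement (𝕜 := 𝕜) φ hφ y] with s hs
  rw [hs, ContinuousLinearMap.flip_apply, map_smul, RCLike.real_smul_eq_coe_smul (K := 𝕜), map_smul,
    smul_apply]

theorem continuous_shift {φ : ℝ → ℝ} (hφ : Continuous φ) (t : ℝ) :
    Continuous fun x => φ (x - t) := by fun_prop

/-- On test functions supported in the open interval, the preadjoint semigroup is a shift for small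
times. -/
theorem preadjointSemigroup_testElement {B' : F →L[𝕜] F} (hB' : ‖B'‖ ≤ 1) {φ : ℝ → ℝ}
    (hφ : Continuous φ) {δ : ℝ} (hδ : 0 < δ) (hz : ∀ x ∉ Icc δ (1 - δ), φ x = 0) (y : F) {t : ℝ≥0}
    (ht : (t : ℝ) < δ) (hδ1 : δ < 1 / 2) :
    preadjointSemigroup B' hB' t (testElement (𝕜 := 𝕜) φ hφ y)
      = testElement (𝕜 := 𝕜) (fun x => φ (x - t)) (continuous_shift hφ t) y := by
  refine Lp.ext ?_
  filter_upwards [coeFn_preadjointSemigroup hB' t (testElement (𝕜 := 𝕜) φ hφ y),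
    coeFn_testElement (𝕜 := 𝕜) (fun x => φ (x - t)) (continuous_shift hφ t) y,
    (quasiMeasurePreserving_reflect t).ae (iterExt_congr_ae B'
      (measurePreserving_one_sub.quasiMeasurePreserving.ae_eq
        (coeFn_testElement (𝕜 := 𝕜) φ hφ y))),
    ae_unitMeasure_mem_Ioo] with x h₁ h₂ h₃ hx
  have h₃' : iterExt B' (fun y_1 => testElement (𝕜 := 𝕜) φ hφ y (1 - y_1)) (t + 1 - x)
    = iterExt B' (fun z => ((φ (1 - z) : ℝ) : 𝕜) • y) (t + 1 - x) := h₃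
  rw [h₁, h₂, h₃']
  rcases lt_or_ge (t : ℝ) x with hlt | hge
  · rw [iterExt_of_mem_Ico B' _ ⟨by linarith [t.coe_nonneg, hx.2], by linarith⟩]
    congr 3
    ring
  · rw [iterExt_eq B' _ (n := 1) (by push_cast; linarith) (by push_cast; linarith [hx.1]),
      hz (x - t) fun h => by linarith [h.1],
      hz _ fun h => by
        have := h.2
        push_cast at this
        linarith [hx.1]]
    simp

/-- Weak convergence of the difference quotients is tested on smooth functions, where the semigroup
can be moved to the test function and becomes a shift. -/
theorem hasWeakDeriv_of_tendsto {b : E →L[𝕜] F →L[𝕜] 𝕜} {B : E →L[𝕜] E} {B' : F →L[𝕜] F}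
    (h : ∀ x y, b (B x) y = b x (B' y)) (hb : ∀ x, (∀ y, b x y = 0) → x = 0) (hB : ‖B‖ ≤ 1)
    (hB' : ‖B'‖ ≤ 1) {f g : Lp E ∞ unitMeasure}
    (hlim : ∀ k : Lp F 1 unitMeasure, Tendsto (fun t : ℝ≥0 => intervalPairing b
      ((((t : ℝ)⁻¹ : ℝ) : 𝕜) • (transportSemigroup B hB t f - f)) k) (𝓝[>] 0)
      (𝓝 (intervalPairing b g k))) : HasWeakDeriv f g := by
  intro φ hφ hc hs
  rw [← sub_eq_zero]
  refine hb _ fun y => ?_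
  have hfi : Integrable f unitMeasure := (Lp.memLp f).integrable le_top
  obtain ⟨δ, hδ, hδ1, hz⟩ := exists_Icc_of_tsupport_subset hc hs
  obtain ⟨K, hK⟩ := (hφ.of_le (by simp) : ContDiff ℝ 1 φ).lipschitzWith_of_hasCompactSupport hc
    one_ne_zero
  have hlip : ∀ (t x : ℝ), |φ (x - t) - φ x| ≤ K * |t| := fun t x => by
    have := hK.dist_le_mul (x - t) x
    rwa [Real.dist_eq, Real.dist_eq, sub_sub_cancel_left, abs_neg] at this
  -- the difference quotients of the shifted test function
  set q : ℝ≥0 → ℝ → ℝ := fun t x => (t : ℝ)⁻¹ * (φ (x - t) - φ x) with hq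
  have hqc : ∀ t, Continuous (q t) := fun t =>
    continuous_const.mul ((continuous_shift hφ.continuous t).sub hφ.continuous)
  have hD : Tendsto (fun t : ℝ≥0 => ∫ x in Icc (0 : ℝ) 1, q t x • f x) (𝓝[>] 0)
      (𝓝 (∫ x in Icc (0 : ℝ) 1, (-deriv φ x) • f x)) := by
    refine tendsto_integral_filter_of_dominated_convergence (fun x => K * ‖f x‖)
      (Eventually.of_forall fun t =>
        (hqc t).aestronglyMeasurable.smul (Lp.aestronglyMeasurable f)) ?_
      (hfi.norm.const_mul _) (Eventually.of_forall fun x => ?_)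
    · filter_upwards [self_mem_nhdsWithin] with t ht
      refine Eventually.of_forall fun x => ?_
      rw [norm_smul]
      refine mul_le_mul_of_nonneg_right ?_ (norm_nonneg _)
      have ht' : (0 : ℝ) < t := NNReal.coe_pos.2 ht
      rw [hq, norm_mul, norm_inv, Real.norm_of_nonneg ht'.le, inv_mul_le_iff₀ ht', mul_comm]
      have := hlip t x
      rwa [abs_of_pos ht'] at this
    · refine Tendsto.smul_const ?_ _
      have hder : HasDerivAt (fun s : ℝ => φ (x - s)) (-deriv φ x) 0 := by
        have h1 : HasDerivAt φ (deriv φ x) (x - 0) := by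
          rw [sub_zero]
          exact (hφ.differentiable (by simp) x).hasDerivAt
        exact h1.comp_const_sub x 0
      have := (hder.tendsto_slope_zero.mono_left (nhdsGT_le_nhdsNE 0)).comp tendsto_coe_nhdsGT_zero
      refine this.congr fun t => ?_
      simp [hq]
  have hD' := ((b.flip y).continuous.tendsto _).comp hD
  have hsmall : ∀ᶠ t : ℝ≥0 in 𝓝[>] 0, (t : ℝ) < δ :=
    (tendsto_coe_nhdsGT_zero.mono_right nhdsWithin_le_nhds).eventually_lt_const hδ
  have hlim' := hlim (testElement (𝕜 := 𝕜) φ hφ.continuous y)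
  have heq := tendsto_nhds_unique (hlim'.congr' ?_) hD'
  · rw [intervalPairing_testElement] at heq
    rw [map_sub, map_neg, sub_neg_eq_add, add_apply, heq, ContinuousLinearMap.flip_apply]
    simp_rw [neg_smul]
    rw [integral_neg, map_neg, neg_apply, add_neg_cancel]
  · filter_upwards [hsmall] with t ht
    rw [map_smul, smul_apply, map_sub, sub_apply,
      intervalPairing_transportSemigroup h hB hB',
      preadjointSemigroup_testElement hB' hφ.continuous hδ hz y ht hδ1,
      intervalPairing_testElement, intervalPairing_testElement, Function.comp_apply,
      ContinuousLinearMap.flip_apply, ← sub_apply, ← map_sub,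
      ← integral_sub (integrable_continuous_smul (continuous_shift hφ.continuous t) hfi)
        (integrable_continuous_smul hφ.continuous hfi), ← smul_apply,
      ← map_smul, ← RCLike.real_smul_eq_coe_smul (K := 𝕜), ← integral_smul]
    congr 3
    ext x
    rw [hq, ← sub_smul, smul_smul]

theorem isBiContGenerator_transportOperator [SMulCommClass ℝ 𝕜 E] {b : E →L[𝕜] F →L[𝕜] 𝕜}
    {B : E →L[𝕜] E} {B' : F →L[𝕜] F} (h : ∀ x y, b (B x) y = b x (B' y))
    (hb : ∀ x, (∀ y, b x y = 0) → x = 0) (hB : ‖B‖ ≤ 1) (hB' : ‖B'‖ ≤ 1) :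
    IsBiContGenerator (pairingTopology b) (transportSemigroup B hB) (transportOperator B) := by
  intro f g
  rw [mem_graph_transportOperator, tendsto_pairingTopology_iff]
  constructor
  · rintro ⟨hw, hbd⟩
    refine ⟨tendsto_intervalPairing_of_hasWeakDeriv b hB hw hbd, ‖g‖, fun t ht _ => ?_⟩
    rw [div_le_iff₀ (NNReal.coe_pos.2 ht)]
    exact norm_transportSemigroup_sub_le hB hw hbd t
  · rintro ⟨hlim, C, hC⟩
    have hw := hasWeakDeriv_of_tendsto h hb hB hB' hlim
    exact ⟨hw, mem_boundarySpace_of_norm_le hB hw hC⟩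

end Generator

/-! ### The duality of `L¹([0,1], F)` and `L^∞([0,1], E)` in coordinates -/

section WeakStar

variable {𝕜 J F : Type*} [RCLike 𝕜] [NormedAddCommGroup F] [NormedSpace 𝕜 F] {e : J → F}

variable (𝕜 F) in
/-- The elements `ψ ⊗ y`, `s ↦ ψ(s) y`, of `L¹([0,1], F)`. -/
def elementaryTensor : F →L[𝕜] Lp 𝕜 1 unitMeasure →L[𝕜] Lp F 1 unitMeasure :=
  (ContinuousLinearMap.lsmul 𝕜 𝕜).flip.compLpL₂ 1 unitMeasure

theorem coeFn_elementaryTensor (y : F) (ψ : Lp 𝕜 1 unitMeasure) :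
    elementaryTensor 𝕜 F y ψ =ᵐ[unitMeasure] fun s => ψ s • y :=
  ContinuousLinearMap.coeFn_compLp _ ψ

/-- If the span of the `e_j` is dense, then a functional on `L¹([0,1], F)` is determined by its
values on the elements `ψ ⊗ e_j` with bounded `ψ`. -/
theorem ext_elementaryTensor (he : Dense (Submodule.span 𝕜 (range e) : Set F))
    {Φ Ψ : Lp F 1 unitMeasure →L[𝕜] 𝕜}
    (h : ∀ j, ∀ ψ : Lp 𝕜 1 unitMeasure, (∃ C, ∀ᵐ s ∂unitMeasure, ‖ψ s‖ ≤ C) →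
      Φ (elementaryTensor 𝕜 F (e j) ψ) = Ψ (elementaryTensor 𝕜 F (e j) ψ)) :
    Φ = Ψ := by
  have htensor : ∀ y, ∀ ψ : Lp 𝕜 1 unitMeasure, (∃ C, ∀ᵐ s ∂unitMeasure, ‖ψ s‖ ≤ C) →
      Φ (elementaryTensor 𝕜 F y ψ) = Ψ (elementaryTensor 𝕜 F y ψ) := by
    intro y ψ hψ
    refine DFunLike.congr_fun (ContinuousLinearMap.ext_on he
      (f := Φ.comp ((elementaryTensor 𝕜 F).flip ψ))
      (g := Ψ.comp ((elementaryTensor 𝕜 F).flip ψ)) ?_) y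
    rintro _ ⟨j, rfl⟩
    exact h j ψ hψ
  refine ContinuousLinearMap.ext fun k => ?_
  induction k using Lp.induction ENNReal.one_ne_top with
  | indicatorConst c hs hμs =>
    rename_i S
    have hψ : MemLp (S.indicator fun _ => (1 : 𝕜)) 1 unitMeasure :=
      memLp_indicator_const 1 hs 1 (Or.inr hμs.ne)
    have heq : (Lp.simpleFunc.indicatorConst 1 hs hμs.ne c : Lp F 1 unitMeasure)
        = elementaryTensor 𝕜 F c (hψ.toLp) := by
      rw [Lp.simpleFunc.coe_indicatorConst]
      refine Lp.ext ?_
      filter_upwards [coeFn_elementaryTensor c hψ.toLp, hψ.coeFn_toLp,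
        indicatorConstLp_coeFn (p := 1) (hs := hs) (hμs := hμs.ne) (c := c)] with s h₁ h₂ h₃
      rw [h₁, h₂, h₃]
      by_cases hsS : s ∈ S
      · rw [indicator_of_mem hsS, indicator_of_mem hsS, one_smul]
      · rw [indicator_of_notMem hsS, indicator_of_notMem hsS, zero_smul]
    rw [heq]
    refine htensor c _ ⟨1, ?_⟩
    filter_upwards [hψ.coeFn_toLp] with s hs'
    rw [hs']
    exact (norm_indicator_le_norm_self _ _).trans norm_one.le
  | add hf hg _ ihf ihg => rw [map_add, map_add, ihf, ihg]
  | isClosed => exact isClosed_eq Φ.continuous Ψ.continuous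

/-- If a functional on `L¹([0,1], F)` is given in coordinates by integrable functions `h_j`, then
`∑_j |h_j(s)|` is at most its norm. It is tested on `∑_j ψ_j ⊗ e_j` with
`ψ_j = 1_S conj(h_j) / |h_j|`, whose norm is at most the measure of `S`. -/
theorem ae_sum_norm_le_norm [Countable J]
    (he : ∀ (A : Finset J) (a : J → 𝕜) (C : ℝ), 0 ≤ C → (∀ j, ‖a j‖ ≤ C) →
      ‖∑ j ∈ A, a j • e j‖ ≤ C) (Φ : Lp F 1 unitMeasure →L[𝕜] 𝕜) {h : J → ℝ → 𝕜}
    (hi : ∀ j, Integrable (h j) unitMeasure)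
    (hΦ : ∀ j, ∀ ψ : Lp 𝕜 1 unitMeasure, (∃ C, ∀ᵐ s ∂unitMeasure, ‖ψ s‖ ≤ C) →
      Φ (elementaryTensor 𝕜 F (e j) ψ) = ∫ s in Icc (0 : ℝ) 1, h j s * ψ s) :
    ∀ᵐ s ∂unitMeasure, ∀ A : Finset J, ∑ j ∈ A, ‖h j s‖ ≤ ‖Φ‖ := by
  rw [ae_all_iff]
  intro A
  have hsum : Integrable (fun s => ∑ j ∈ A, ‖h j s‖) unitMeasure :=
    integrable_finsetSum _ fun j _ => (hi j).norm
  refine ae_le_of_forall_setIntegral_le hsum (integrable_const ‖Φ‖) fun S hS _ => ?_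
  set σ : J → ℝ → 𝕜 := fun j => S.indicator fun s => (starRingEnd 𝕜 (h j s)) * ((‖h j s‖⁻¹ : ℝ) : 𝕜)
    with hσ
  have hσle : ∀ j s, ‖σ j s‖ ≤ S.indicator (fun _ => (1 : ℝ)) s := fun j s => by
    rw [hσ, norm_indicator_eq_indicator_norm]
    refine indicator_le_indicator ?_
    rw [norm_mul, RCLike.norm_conj, RCLike.norm_ofReal, abs_inv, abs_norm]
    exact mul_inv_le_one
  have hσle1 : ∀ j s, ‖σ j s‖ ≤ 1 := fun j s =>
    (hσle j s).trans (indicator_le_self' (fun _ _ => zero_le_one) s)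
  have hσm : ∀ j, AEStronglyMeasurable (σ j) unitMeasure := fun j => by
    refine AEStronglyMeasurable.indicator ?_ hS
    refine (RCLike.continuous_conj.comp_aestronglyMeasurable (hi j).1).mul ?_
    exact (RCLike.continuous_ofReal.measurable.comp_aemeasurable
      (hi j).1.norm.aemeasurable.inv).aestronglyMeasurable
  have hσi : ∀ j, Integrable (σ j) unitMeasure := fun j =>
    Integrable.of_bound (hσm j) 1 (Eventually.of_forall (hσle1 j))
  have hσprod : ∀ j s, h j s * σ j s = ((S.indicator (fun s => ‖h j s‖) s : ℝ) : 𝕜) := fun j s => by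
    by_cases hs : s ∈ S
    · simp only [hσ, indicator_of_mem hs]
      rw [← mul_assoc, RCLike.mul_conj, ← RCLike.ofReal_pow, ← RCLike.ofReal_mul, sq]
      congr 1
      exact mul_self_mul_inv _
    · simp only [hσ, indicator_of_notMem hs, mul_zero, RCLike.ofReal_zero]
  set k : Lp F 1 unitMeasure :=
    ∑ j ∈ A, elementaryTensor 𝕜 F (e j) ((hσi j).toL1 (σ j)) with hk
  have hkae : ∀ᵐ s ∂unitMeasure, k s = ∑ j ∈ A, σ j s • e j := by
    have hall : ∀ᵐ s ∂unitMeasure, ∀ j,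
        elementaryTensor 𝕜 F (e j) ((hσi j).toL1 (σ j)) s = σ j s • e j := by
      rw [ae_all_iff]
      intro j
      filter_upwards [coeFn_elementaryTensor (e j) ((hσi j).toL1 (σ j)),
        (hσi j).coeFn_toL1] with s h₁ h₂
      rw [h₁, h₂]
    filter_upwards [Lp.coeFn_fun_finsetSum (s := A)
      (f := fun j => elementaryTensor 𝕜 F (e j) ((hσi j).toL1 (σ j))), hall] with s h₁ h₂
    rw [h₁]
    exact Finset.sum_congr rfl fun j _ => h₂ j
  have hknorm : ‖k‖ ≤ ∫ s in Icc (0 : ℝ) 1, S.indicator (fun _ => (1 : ℝ)) s := by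
    rw [L1.norm_eq_integral_norm]
    refine integral_mono_ae (L1.integrable_coeFn k).norm ((integrable_const 1).indicator hS) ?_
    filter_upwards [hkae] with s hs
    rw [hs]
    exact he A (fun j => σ j s) _ (indicator_nonneg (fun _ _ => zero_le_one) s) fun j => hσle j s
  have hval : Φ k = ((∫ s in S, ∑ j ∈ A, ‖h j s‖ ∂unitMeasure : ℝ) : 𝕜) := by
    rw [hk, map_sum, integral_finsetSum _ fun j _ => (hi j).norm.restrict, RCLike.ofReal_sum]
    refine Finset.sum_congr rfl fun j _ => ?_
    rw [hΦ j _ ⟨1, by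
      filter_upwards [(hσi j).coeFn_toL1] with s hs
      rw [hs]
      exact hσle1 j s⟩, ← integral_indicator hS, ← integral_ofReal]
    apply integral_congr_ae
    filter_upwards [(hσi j).coeFn_toL1] with s hs
    rw [hs, hσprod]
  calc ∫ s in S, ∑ j ∈ A, ‖h j s‖ ∂unitMeasure = ‖Φ k‖ := by
        rw [hval, RCLike.norm_ofReal, abs_of_nonneg]
        exact integral_nonneg fun s => Finset.sum_nonneg fun j _ => norm_nonneg _
    _ ≤ ‖Φ‖ * ‖k‖ := Φ.le_opNorm k
    _ ≤ ‖Φ‖ * ∫ s in Icc (0 : ℝ) 1, S.indicator (fun _ => (1 : ℝ)) s := by gcongr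
    _ = ∫ _ in S, ‖Φ‖ ∂unitMeasure := by
        rw [integral_indicator hS, ← integral_const_mul]
        simp only [mul_one]

/-- The coordinate description of a duality between Banach spaces of the kind `(ℓ¹, c₀)`: the `e_j`
are total in `F`, finite sums `∑ a_j e_j` have norm at most `sup |a_j|`, and `E` is the space of the
absolutely summable families of coordinates `x_j = b(x, e_j)`. Measurability of an `E`-valued
function is measurability of its coordinates. -/
structure IsCoordinatePairing {E : Type*} [NormedAddCommGroup E] [NormedSpace 𝕜 E]
    (b : E →L[𝕜] F →L[𝕜] 𝕜) (e : J → F) : Prop where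
  norm_apply_le : ∀ x y, ‖b x y‖ ≤ ‖x‖ * ‖y‖
  dense_span : Dense (Submodule.span 𝕜 (range e) : Set F)
  norm_sum_le : ∀ (A : Finset J) (a : J → 𝕜) (C : ℝ), 0 ≤ C → (∀ j, ‖a j‖ ≤ C) →
    ‖∑ j ∈ A, a j • e j‖ ≤ C
  norm_le : ∀ (x : E) (C : ℝ), 0 ≤ C → (∀ A : Finset J, ∑ j ∈ A, ‖b x (e j)‖ ≤ C) → ‖x‖ ≤ C
  exists_eq : ∀ (a : J → 𝕜) (C : ℝ), (∀ A : Finset J, ∑ j ∈ A, ‖a j‖ ≤ C) →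
    ∃ x : E, ∀ j, b x (e j) = a j
  aestronglyMeasurable : ∀ f : ℝ → E,
    (∀ j, AEStronglyMeasurable (fun s => b (f s) (e j)) unitMeasure) →
    AEStronglyMeasurable f unitMeasure

variable {E : Type*} [NormedAddCommGroup E] [NormedSpace 𝕜 E] {b : E →L[𝕜] F →L[𝕜] 𝕜}

theorem intervalPairing_elementaryTensor (f : Lp E ∞ unitMeasure) (y : F)
    (ψ : Lp 𝕜 1 unitMeasure) :
    intervalPairing b f (elementaryTensor 𝕜 F y ψ) = ∫ s in Icc (0 : ℝ) 1, b (f s) y * ψ s := by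
  rw [ContinuousLinearMap.lpPairing_eq_integral]
  apply integral_congr_ae
  filter_upwards [coeFn_elementaryTensor y ψ] with s hs
  rw [hs, map_smul, smul_eq_mul, mul_comm]

theorem integrable_coord (b : E →L[𝕜] F →L[𝕜] 𝕜) (f : Lp E ∞ unitMeasure) (y : F) :
    Integrable (fun s => b (f s) y) unitMeasure :=
  ContinuousLinearMap.integrable_comp (b.flip y) ((Lp.memLp f).integrable le_top)

namespace IsCoordinatePairing

theorem eq_zero (h : IsCoordinatePairing b e) {x : E} (hx : ∀ y, b x y = 0) : x = 0 :=
  norm_le_zero_iff.1 (h.norm_le x 0 le_rfl fun A => by simp [hx])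

theorem norm_le_norm_intervalPairing [Countable J] (h : IsCoordinatePairing b e)
    (f : Lp E ∞ unitMeasure) : ‖f‖ ≤ ‖intervalPairing b f‖ := by
  refine norm_le_of_ae_norm_le (norm_nonneg _) ?_
  filter_upwards [ae_sum_norm_le_norm h.norm_sum_le (intervalPairing b f)
    (h := fun j s => b (f s) (e j)) (fun j => integrable_coord b f (e j))
    fun j ψ _ => intervalPairing_elementaryTensor f (e j) ψ] with s hs
  exact h.norm_le _ _ (norm_nonneg _) hs

theorem norm_intervalPairing_apply_le (h : IsCoordinatePairing b e) (f : Lp E ∞ unitMeasure)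
    (k : Lp F 1 unitMeasure) : ‖intervalPairing b f k‖ ≤ ‖f‖ * ‖k‖ := by
  rw [ContinuousLinearMap.lpPairing_eq_integral, L1.norm_eq_integral_norm, ← integral_const_mul]
  refine norm_integral_le_of_norm_le ((L1.integrable_coeFn k).norm.const_mul _) ?_
  filter_upwards [ae_norm_coeFn_le_norm f] with s hs
  refine (h.norm_apply_le _ _).trans ?_
  gcongr

/-- The duality `L¹([0,1], F)' = L^∞([0,1], E)`. The coordinates of the representing function are
obtained from the Fréchet–Riesz theorem in `L²([0,1])`. -/
theorem exists_intervalPairing_eq [Countable J] (h : IsCoordinatePairing b e)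
    (Φ : Lp F 1 unitMeasure →L[𝕜] 𝕜) : ∃ f : Lp E ∞ unitMeasure, intervalPairing b f = Φ := by
  -- the inclusion of `L²` in `L¹`, as the product with the constant function `1`
  have h1 : MemLp (fun _ : ℝ => (1 : 𝕜)) 2 unitMeasure := memLp_const 1
  set ι : Lp 𝕜 2 unitMeasure →L[𝕜] Lp 𝕜 1 unitMeasure :=
    (ContinuousLinearMap.mul 𝕜 𝕜).holderL unitMeasure 2 2 1 h1.toLp with hι
  have hιae : ∀ ψ, ι ψ =ᵐ[unitMeasure] ψ := fun ψ => by
    filter_upwards [ContinuousLinearMap.coeFn_holder (r := 1) (ContinuousLinearMap.mul 𝕜 𝕜)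
      h1.toLp ψ, h1.coeFn_toLp] with s h₁ h₂
    refine Eq.trans h₁ ?_
    rw [h₂, ContinuousLinearMap.mul_apply', one_mul]
  set η : J → Lp 𝕜 2 unitMeasure := fun j => (InnerProductSpace.toDual 𝕜 _).symm
    (Φ.comp ((elementaryTensor 𝕜 F (e j)).comp ι)) with hη
  have hηinner : ∀ j ψ, ∫ s in Icc (0 : ℝ) 1, starRingEnd 𝕜 (η j s) * ψ s
      = Φ (elementaryTensor 𝕜 F (e j) (ι ψ)) := fun j ψ => by
    have h₁ : inner 𝕜 (η j) ψ = Φ (elementaryTensor 𝕜 F (e j) (ι ψ)) := by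
      rw [hη, InnerProductSpace.toDual_symm_apply]
      rfl
    rw [← h₁, L2.inner_def]
    exact integral_congr_ae (Eventually.of_forall fun s =>
      (mul_comm _ _).trans (RCLike.inner_apply (η j s) (ψ s)).symm)
  have hηi : ∀ j, Integrable (fun s => starRingEnd 𝕜 (η j s)) unitMeasure := fun j =>
    (RCLike.conjCLE (K := 𝕜) : 𝕜 →L[ℝ] 𝕜).integrable_comp
      ((Lp.memLp (η j)).integrable one_le_two)
  have hΦ : ∀ j, ∀ ψ : Lp 𝕜 1 unitMeasure, (∃ C, ∀ᵐ s ∂unitMeasure, ‖ψ s‖ ≤ C) →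
      Φ (elementaryTensor 𝕜 F (e j) ψ)
        = ∫ s in Icc (0 : ℝ) 1, starRingEnd 𝕜 (η j s) * ψ s := by
    rintro j ψ ⟨C, hC⟩
    have hψ : MemLp ψ 2 unitMeasure := MemLp.of_bound (Lp.aestronglyMeasurable ψ) C hC
    have hιψ : ι hψ.toLp = ψ := Lp.ext ((hιae _).trans hψ.coeFn_toLp)
    rw [← hιψ, ← hηinner, hιψ]
    apply integral_congr_ae
    filter_upwards [hψ.coeFn_toLp] with s hs
    rw [hs]
  have hbd := ae_sum_norm_le_norm h.norm_sum_le Φ hηi hΦ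
  have hex : ∀ s, ∃ x : E, (∀ A : Finset J, ∑ j ∈ A, ‖starRingEnd 𝕜 (η j s)‖ ≤ ‖Φ‖) →
      ∀ j, b x (e j) = starRingEnd 𝕜 (η j s) := fun s => by
    by_cases hs : ∀ A : Finset J, ∑ j ∈ A, ‖starRingEnd 𝕜 (η j s)‖ ≤ ‖Φ‖
    · obtain ⟨x, hx⟩ := h.exists_eq _ _ hs
      exact ⟨x, fun _ => hx⟩
    · exact ⟨0, fun h => absurd h hs⟩
  choose f₀ hf₀ using hex
  have hcoord : ∀ᵐ s ∂unitMeasure, ∀ j, b (f₀ s) (e j) = starRingEnd 𝕜 (η j s) := by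
    filter_upwards [hbd] with s hs using hf₀ s hs
  have hmeas : AEStronglyMeasurable f₀ unitMeasure := h.aestronglyMeasurable f₀ fun j =>
    (hηi j).1.congr (by filter_upwards [hcoord] with s hs using (hs j).symm)
  have hmem : MemLp f₀ ∞ unitMeasure := by
    refine memLp_top_of_bound hmeas ‖Φ‖ ?_
    filter_upwards [hbd, hcoord] with s h₁ h₂
    exact h.norm_le _ _ (norm_nonneg _) fun A => by simpa only [h₂] using h₁ A
  refine ⟨hmem.toLp, ext_elementaryTensor h.dense_span fun j ψ hψ => ?_⟩
  rw [intervalPairing_elementaryTensor, hΦ j ψ hψ]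
  apply integral_congr_ae
  filter_upwards [hcoord, hmem.coeFn_toLp] with s h₁ h₂
  rw [h₂, h₁]

theorem t2Space [Countable J] (h : IsCoordinatePairing b e) :
    @T2Space _ (pairingTopology b) := by
  let _ := pairingTopology b
  refine T2Space.of_injective_continuous
    (f := fun f : Lp E ∞ unitMeasure => fun k => intervalPairing b f k) (fun f₁ f₂ hf => ?_)
    (continuous_pi fun k => continuous_intervalPairing b k)
  have h0 : intervalPairing b (f₁ - f₂) = 0 := by
    rw [map_sub, sub_eq_zero]
    exact ContinuousLinearMap.ext fun k => congr_fun hf k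
  have := h.norm_le_norm_intervalPairing (f₁ - f₂)
  rw [h0, norm_zero] at this
  exact sub_eq_zero.1 (norm_le_zero_iff.1 this)

theorem seqComplete [Countable J] (h : IsCoordinatePairing b e) (f : ℕ → Lp E ∞ unitMeasure)
    {C : ℝ} (hC : ∀ n, ‖f n‖ ≤ C)
    (hf : Tendsto (fun p : ℕ × ℕ => f p.1 - f p.2) atTop (@nhds _ (pairingTopology b) 0)) :
    ∃ g, Tendsto f atTop (@nhds _ (pairingTopology b) g) := by
  rw [tendsto_pairingTopology_iff] at hf
  have hcauchy : ∀ k, ∃ l, Tendsto (fun n => intervalPairing b (f n) k) atTop (𝓝 l) := fun k => by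
    refine cauchySeq_tendsto_of_complete (cauchySeq_iff_tendsto_dist_atTop_0.2 ?_)
    have := (hf k).norm
    simpa only [map_sub, map_zero, sub_apply, zero_apply, norm_zero, dist_eq_norm] using this
  choose l hl using hcauchy
  let Φ₀ : Lp F 1 unitMeasure →ₗ[𝕜] 𝕜 :=
    linearMapOfTendsto l (fun n => (intervalPairing b (f n) : Lp F 1 unitMeasure →ₗ[𝕜] 𝕜))
      (tendsto_pi_nhds.2 hl)
  let Φ : Lp F 1 unitMeasure →L[𝕜] 𝕜 := Φ₀.mkContinuous C fun k => by
    refine le_of_tendsto (hl k).norm (Eventually.of_forall fun n => ?_)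
    refine (h.norm_intervalPairing_apply_le (f n) k).trans ?_
    gcongr
    exact hC n
  obtain ⟨g, hg⟩ := h.exists_intervalPairing_eq Φ
  refine ⟨g, (tendsto_pairingTopology_iff b).2 fun k => ?_⟩
  rw [hg]
  exact hl k

theorem norming [Countable J] (h : IsCoordinatePairing b e) (f : Lp E ∞ unitMeasure) :
    IsLUB {r : ℝ | ∃ φ : BoundedFunctional 𝕜 (Lp E ∞ unitMeasure),
      @Continuous _ 𝕜 (pairingTopology b) inferInstance (fun x => φ x) ∧ ‖φ‖ ≤ 1 ∧ r = ‖φ f‖}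
      ‖f‖ := by
  refine ⟨?_, fun M hM => ?_⟩
  · rintro _ ⟨φ, -, hφ, rfl⟩
    simpa using φ.le_of_opNorm_le hφ f
  · have hM0 : 0 ≤ M := hM ⟨0, by simpa using @continuous_const _ _ (pairingTopology b) _ 0,
      by simp, by simp⟩
    refine (h.norm_le_norm_intervalPairing f).trans
      (ContinuousLinearMap.opNorm_le_bound _ hM0 fun k => ?_)
    rcases eq_or_ne k 0 with rfl | hk
    · simp
    have hk0 : 0 < ‖k‖ := norm_pos_iff.2 hk
    have hflip : ‖(intervalPairing b).flip k‖ ≤ ‖k‖ :=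
      ContinuousLinearMap.opNorm_le_bound _ hk0.le fun x => by
        rw [mul_comm]
        exact h.norm_intervalPairing_apply_le x k
    have hcont : @Continuous _ 𝕜 (pairingTopology b) _
        fun x => ((‖k‖⁻¹ : ℝ) : 𝕜) • intervalPairing b x k :=
      @Continuous.fun_const_smul _ _ _ _ _ _ (pairingTopology b) _
        (continuous_intervalPairing b k) _
    have hmem := hM ⟨((‖k‖⁻¹ : ℝ) : 𝕜) • (intervalPairing b).flip k, hcont, by
        rw [norm_smul, RCLike.norm_ofReal, abs_inv, abs_norm]
        exact (mul_le_mul_of_nonneg_left hflip (by positivity)).trans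
          (inv_mul_cancel₀ hk0.ne').le, rfl⟩
    rw [smul_apply, norm_smul, RCLike.norm_ofReal, abs_inv, abs_norm, inv_mul_le_iff₀ hk0,
      ContinuousLinearMap.flip_apply] at hmem
    rwa [mul_comm]

theorem isBiContTopology [Countable J] [CompleteSpace E] (h : IsCoordinatePairing b e) :
    IsBiContTopology 𝕜 (pairingTopology b) where
  complete := inferInstance
  topologicalAddGroup := isTopologicalAddGroup_pairingTopology b
  continuousSMul := continuousSMul_pairingTopology b
  polynormable := polynormableSpace_pairingTopology b
  hausdorff := h.t2Space
  coarser := (continuous_pairingTopology_iff b).2 fun k =>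
    ((intervalPairing b).flip k).continuous
  seqComplete := by
    rintro f ⟨C, hC⟩ hf
    exact h.seqComplete f hC hf
  norming := h.norming

end IsCoordinatePairing

end WeakStar

/-! ### The transport semigroup on a network -/

section Network

variable {𝕜 J : Type*} [RCLike 𝕜]

theorem dense_span_cSingle :
    Dense (Submodule.span 𝕜 (range (cSingle 𝕜 (J := J))) : Set (cZero J 𝕜)) :=
  fun y => mem_closure_of_tendsto (hasSum_smul_cSingle y) (Eventually.of_forall fun _ =>
    Submodule.sum_mem _ fun j _ => Submodule.smul_mem _ _ (Submodule.subset_span ⟨j, rfl⟩))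

theorem norm_sum_smul_cSingle_le (A : Finset J) (a : J → 𝕜) (C : ℝ) (hC : 0 ≤ C)
    (ha : ∀ j, ‖a j‖ ≤ C) : ‖∑ j ∈ A, a j • cSingle 𝕜 j‖ ≤ C := by
  classical
  refine norm_cZero_le hC fun i => ?_
  rw [sum_smul_cSingle_apply]
  split_ifs
  · exact ha i
  · rw [norm_zero]
    exact hC

/-- As `J` is countable, an `ℓ¹`-valued function is strongly measurable if its coordinates are: it
is the limit of its finite sections. -/
theorem aestronglyMeasurable_of_coord [Countable J] {f : ℝ → ℓ¹(J, 𝕜)} {μ : Measure ℝ}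
    (hf : ∀ j, AEStronglyMeasurable (fun s => f s j) μ) : AEStronglyMeasurable f μ := by
  classical
  refine aestronglyMeasurable_of_tendsto_ae (u := (atTop : Filter (Finset J)))
    (f := fun A s => ∑ j ∈ A, lp.single 1 j (f s j)) (fun A => ?_)
    (Eventually.of_forall fun s => lp.hasSum_single ENNReal.one_ne_top (f s))
  exact Finset.aestronglyMeasurable_fun_sum A fun j _ =>
    (lp.isometry_single (E := fun _ : J => 𝕜) (p := 1) j).continuous.comp_aestronglyMeasurable
      (hf j)

theorem isCoordinatePairing_sumPairing [Countable J] :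
    IsCoordinatePairing (sumPairing 𝕜 J) (cSingle 𝕜) where
  norm_apply_le := norm_sumPairing_le
  dense_span := dense_span_cSingle
  norm_sum_le := norm_sum_smul_cSingle_le
  norm_le x C hC h := lp.norm_le_of_forall_sum_le (by simp) hC fun A => by
    simpa [sumPairing_cSingle] using h A
  exists_eq a C h := ⟨⟨a, memℓp_gen' (C := C) fun A => by simpa using h A⟩, fun j =>
    sumPairing_cSingle _ j⟩
  aestronglyMeasurable f hf := aestronglyMeasurable_of_coord fun j => by
    simpa only [sumPairing_cSingle] using hf j

theorem weakStarTopology_eq_pairingTopology :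
    weakStarTopology J 𝕜 = pairingTopology (sumPairing 𝕜 J) := by
  refine iInf_congr fun g => ?_
  congr 1
  ext f
  rw [ContinuousLinearMap.lpPairing_eq_integral]
  rfl

end Network

end

theorem mainTheorem1 {𝕜 V J : Type*} [RCLike 𝕜] [Countable V] [Countable J] (N : Network V J) :
    ∃ T : ℝ≥0 → BoundedOp 𝕜 (StateSpace J 𝕜),
      IsBiContSemigroup (weakStarTopology J 𝕜) T ∧
      (∀ t, ‖T t‖ ≤ 1) ∧
      IsBiContGenerator (weakStarTopology J 𝕜) T (transportOperator (N.adjOp 𝕜)) ∧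
      ∀ (f : StateSpace J 𝕜) (t : ℝ≥0), ∀ᵐ s ∂unitMeasure, ∀ n : ℕ,
        (n : ℝ) ≤ t + s → (t : ℝ) + s < n + 1 →
          (T t f) s = ((N.adjOp 𝕜) ^ n) (f (t + s - n)) := by
  have hb := isCoordinatePairing_sumPairing (𝕜 := 𝕜) (J := J)
  have hadj := N.sumPairing_adjOp (𝕜 := 𝕜)
  have hB := N.norm_adjOp_le (𝕜 := 𝕜)
  have hB' := N.norm_preadjOp_le (𝕜 := 𝕜)
  refine ⟨transportSemigroup (N.adjOp 𝕜) hB, ?_, norm_transportSemigroup_le hB, ?_, fun f t => ?_⟩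
  · rw [weakStarTopology_eq_pairingTopology]
    exact isBiContSemigroup_transportSemigroup hadj hB hB' hb.isBiContTopology
  · rw [weakStarTopology_eq_pairingTopology]
    exact isBiContGenerator_transportOperator hadj (fun x hx => hb.eq_zero hx) hB hB'
  · filter_upwards [coeFn_transportSemigroup hB t f] with s hs n h₁ h₂
    rw [hs, iterExt_eq _ _ h₁ h₂]
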